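/- Let $(V_j)_{j\in\mathbb Z}$ be an orthogonal multiresolution analysis of $L^2(\mathbb R^d)$ with scaling function $\varphi$, and let $\psi^{(1)},\dots,\psi^{(2^d-1)}$ be associated orthonormal wavelets: the functions $\psi^{(i)}(\cdot-k)$ form an orthonormal basis of $V_1\ominus V_0$ and the functions $2^{dj/2}\psi^{(i)}(2^j\cdot-k)$ ($1\le i<2^d$, $j\in\mathbb Z$, $k\in\mathbb Z^d$) form an orthonormal basis of $L^2(\mathbb R^d)$ (functions are all real-valued or all complex-valued). Let $1\le p<\infty$ and $s\ge 0$. Assume that $\varphi$ has fast decay, i.e. $|\varphi(x)|\le C_N(1+\|x\|)^{-N}$ for every $N$, and that the wavelets $\psi^{(i)}$ have compact support and are of class $C^{\lfloor s\rfloor+1}$. For $f\in L^p(\mathbb R^d)$ put $C_k=\int\overline{\varphi(x-k)}f(x)\,dx$ and $c^{(i)}_{j,k}=2^{dj}\int\overline{\psi^{(i)}(2^jx-k)}f(x)\,dx$. For $0<q\le\infty$, the space $B_p^{s,q}(\mathbb R^d)$ consists of the $f\in L^p(\mathbb R^d)$ such that $(C_k)_k\in\ell^p$ and $(\varepsilon_j)_{j\ge1}\in\ell^q$,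 where $\varepsilon_j=2^{(s-d/p)j}\big(\sum_{i,k}|c^{(i)}_{j,k}|^p\big)^{1/p}$. Put, for $j\geq 0$, $$Q_lf(x)=\sum_i\sum_{k}c^{(i)}_{l,k}\psi^{(i)}(2^lx-k),\qquad P_jf(x)=\sum_kC_k\varphi(x-k)+\sum_{0\le l<j}Q_lf(x),\qquad R_jf(x)=\sum_{l\ge j}Q_lf(x).$$ With the convention $\log 0=-\infty$, define $$\mathcal E^+(\beta,f)=\Big\{x\in\mathbb R^d:\ \liminf_{j\to\infty}\frac{\log|P_jf(x)|}{j\log2}\ge\beta\Big\}\quad(\beta>0),$$ $$\mathcal E^+(\beta,f)=\Big\{x\in\mathbb R^d:\ P_jf(x)\text{ converges and }\liminf_{j\to\infty}\frac{\log|R_jf(x)|}{j\log2}\ge\beta\Big\}\quad(\beta<0).$$ Let $\dim_{\mathcal P}$ denote the packing dimension, $\dim_{\mathcal P}(E)=\inf\big\{\sup_n\overline{\dim}_B(E_n):E\subset\bigcup_{n\in\mathbb N}E_n\big\}$, where $\overline{\dim}_B$ is the upper box dimension. (i) If $s>0$, $d=1$ and $1-sp>0$, then for every $\beta\in(-s,\frac1p-s)\setminus\{0\}$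 there exists $f\in B_p^{s,1}(\mathbb R)$ such that $\dim_{\mathcal P}\big(\mathcal E^+(\beta,f)\big)>1-sp-\beta p$. (ii) If $d-sp<0$, then for every $\beta\in(-s,\frac dp-s)\setminus\{0\}$ and every $f\in B_p^{s,\infty}(\mathbb R^d)$, $\dim_{\mathcal P}\big(\mathcal E^+(\beta,f)\big)\le d-sp-\beta p$. -/

import Mathlib

open MeasureTheory Filter Topology Set
open scoped ENNReal NNReal ComplexConjugate

noncomputable section

/-- The upper box-counting (Minkowski) dimension
`limsup_{ε → 0⁺} log N(ε, A) / log (1/ε)`, where `N(ε, A)` is the least number of closed balls of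
radius `ε` covering `A`. It is `0` for the empty set and `∞` for an unbounded subset of `ℝᵈ`. -/
def upperBoxDim {X : Type*} [PseudoEMetricSpace X] (A : Set X) : ℝ≥0∞ :=
  (limsup (fun ε : ℝ≥0 =>
    ENNReal.log ((Metric.externalCoveringNumber ε A : ℕ∞) : ℝ≥0∞) /
      ((-Real.log (ε : ℝ) : ℝ) : EReal)) (𝓝[>] 0)).toENNReal

/-- The packing dimension: the infimum, over all countable covers of `A`, of the supremum of the
upper box dimensions of the pieces. -/
def packingDim {X : Type*} [PseudoEMetricSpace X] (A : Set X) : ℝ≥0∞ :=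
  ⨅ (E : ℕ → Set X) (_ : A ⊆ ⋃ n, E n), ⨆ n, upperBoxDim (E n)

/-- `g` has fast decay: `|g(x)| ≤ C_N (1 + ‖x‖)^(-N)` for every `N`. -/
def HasFastDecay {d : ℕ} {𝕜 : Type*} [RCLike 𝕜] (g : (Fin d → ℝ) → 𝕜) : Prop :=
  ∀ N : ℕ, ∃ C : ℝ, ∀ x : Fin d → ℝ, ‖g x‖ ≤ C / (1 + ‖x‖) ^ N

/-- The function `g_{j,k}(x) = g(2^j x - k)`. -/
def dyadicAtom {d : ℕ} {𝕜 : Type*} (g : (Fin d → ℝ) → 𝕜) (j : ℤ) (k : Fin d → ℤ)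
    (x : Fin d → ℝ) : 𝕜 :=
  g (fun m => (2 : ℝ) ^ j * x m - (k m : ℝ))

/-- The functions `e i` are (representatives of) an orthonormal basis of the closed subspace `V`
of `L²(ℝᵈ)`. -/
def IsOrthonormalBasisOf {d : ℕ} {𝕜 : Type*} [RCLike 𝕜] {ι : Type*}
    (e : ι → (Fin d → ℝ) → 𝕜)
    (V : Submodule 𝕜 (Lp 𝕜 2 (volume : Measure (Fin d → ℝ)))) : Prop :=
  ∃ u : ι → Lp 𝕜 2 (volume : Measure (Fin d → ℝ)),
    (∀ i, ⇑(u i) =ᵐ[volume] e i) ∧ Orthonormal 𝕜 u ∧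
      (Submodule.span 𝕜 (Set.range u)).topologicalClosure = V

/-- An orthogonal multiresolution analysis `(V_j)` of `L²(ℝᵈ)` with scaling function `φ`, together
with an associated orthonormal wavelet basis generated by `ψ⁽¹⁾, …, ψ⁽²^ᵈ⁻¹⁾`; the scaling function
and the wavelets have fast decay. The scalar field is `ℝ` or `ℂ`. -/
structure WaveletSystem (𝕜 : Type*) [RCLike 𝕜] (d : ℕ) where
  /-- the approximation spaces -/
  V : ℤ → Submodule 𝕜 (Lp 𝕜 2 (volume : Measure (Fin d → ℝ)))
  /-- the scaling function -/
  φ : (Fin d → ℝ) → 𝕜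
  /-- the mother wavelets -/
  ψ : Fin (2 ^ d - 1) → (Fin d → ℝ) → 𝕜
  mono : ∀ j, V j ≤ V (j + 1)
  inter : ⨅ j, V j = ⊥
  dense : Dense (⋃ j, (V j : Set (Lp 𝕜 2 (volume : Measure (Fin d → ℝ)))))
  dilation : ∀ (j : ℤ) (f g : Lp 𝕜 2 (volume : Measure (Fin d → ℝ))),
    (∀ᵐ x : Fin d → ℝ, g x = f ((2 : ℝ) • x)) → (f ∈ V j ↔ g ∈ V (j + 1))
  scaling_basis : IsOrthonormalBasisOf (fun k : Fin d → ℤ => dyadicAtom φ 0 k) (V 0)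
  wavelet_detail_basis : IsOrthonormalBasisOf
    (fun a : Fin (2 ^ d - 1) × (Fin d → ℤ) => dyadicAtom (ψ a.1) 0 a.2) (V 1 ⊓ (V 0)ᗮ)
  wavelet_basis : IsOrthonormalBasisOf
    (fun (a : Fin (2 ^ d - 1) × ℤ × (Fin d → ℤ)) (x : Fin d → ℝ) =>
      (((2 : ℝ) ^ ((d : ℝ) * (a.2.1 : ℝ) / 2) : ℝ) : 𝕜) * dyadicAtom (ψ a.1) a.2.1 a.2.2 x) ⊤
  scaling_decay : HasFastDecay φ
  wavelet_decay : ∀ i, HasFastDecay (ψ i)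

namespace WaveletSystem

variable {𝕜 : Type*} [RCLike 𝕜] {d : ℕ}

/-- `C_k = ∫ conj(φ(x - k)) f(x) dx`. -/
def scalingCoeff (W : WaveletSystem 𝕜 d) (f : (Fin d → ℝ) → 𝕜) (k : Fin d → ℤ) : 𝕜 :=
  ∫ x, conj (dyadicAtom W.φ 0 k x) * f x

/-- `c_{j,k}⁽ⁱ⁾ = ∫ 2^{dj} conj(ψ⁽ⁱ⁾(2^j x - k)) f(x) dx`. -/
def waveletCoeff (W : WaveletSystem 𝕜 d) (f : (Fin d → ℝ) → 𝕜)
    (i : Fin (2 ^ d - 1)) (j : ℕ) (k : Fin d → ℤ) : 𝕜 :=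
  ∫ x, (2 : 𝕜) ^ (d * j) * conj (dyadicAtom (W.ψ i) j k x) * f x

/-- `ε_j = 2^{(s - d/p) j} (∑_{i,k} |c_{j,k}⁽ⁱ⁾|^p)^{1/p}`. -/
def besovLevel (W : WaveletSystem 𝕜 d) (p s : ℝ) (f : (Fin d → ℝ) → 𝕜) (j : ℕ) : ℝ :=
  (2 : ℝ) ^ ((s - d / p) * j) *
    (∑' a : Fin (2 ^ d - 1) × (Fin d → ℤ), ‖W.waveletCoeff f a.1 j a.2‖ ^ p) ^ (1 / p)

/-- Membership of `f` in the Besov space `B_p^{s,q}(ℝᵈ)`, `1 ≤ p < ∞`, `0 < q ≤ ∞`: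
`f ∈ Lᵖ`, `(C_k) ∈ ℓᵖ`, every `ε_j` (`j ≥ 1`) is finite and `(ε_j)_{j ≥ 1} ∈ ℓ^q`. -/
def MemBesov (W : WaveletSystem 𝕜 d) (p s : ℝ) (q : ℝ≥0∞) (f : (Fin d → ℝ) → 𝕜) : Prop :=
  MemLp f (ENNReal.ofReal p) volume ∧
  Memℓp (fun k : Fin d → ℤ => W.scalingCoeff f k) (ENNReal.ofReal p) ∧
  (∀ j : ℕ, 1 ≤ j → Summable fun a : Fin (2 ^ d - 1) × (Fin d → ℤ) =>
    ‖W.waveletCoeff f a.1 j a.2‖ ^ p) ∧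
  Memℓp (fun n : ℕ => W.besovLevel p s f (n + 1)) q

/-- `Q_l f(x) = ∑_i ∑_k c_{l,k}⁽ⁱ⁾ ψ⁽ⁱ⁾(2^l x - k)`. -/
def detail (W : WaveletSystem 𝕜 d) (f : (Fin d → ℝ) → 𝕜) (l : ℕ) (x : Fin d → ℝ) : 𝕜 :=
  ∑ i, ∑' k : Fin d → ℤ, W.waveletCoeff f i l k * dyadicAtom (W.ψ i) l k x

/-- The partial reconstruction `P_j f(x) = ∑_k C_k φ(x - k) + ∑_{l < j} Q_l f(x)`. -/
def reconstruction (W : WaveletSystem 𝕜 d) (f : (Fin d → ℝ) → 𝕜) (j : ℕ) (x : Fin d → ℝ) : 𝕜 :=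
  (∑' k : Fin d → ℤ, W.scalingCoeff f k * dyadicAtom W.φ 0 k x) +
    ∑ l ∈ Finset.range j, W.detail f l x

/-- `P_j f(x)` converges as `j → ∞`. -/
def ConvergesAt (W : WaveletSystem 𝕜 d) (f : (Fin d → ℝ) → 𝕜) (x : Fin d → ℝ) : Prop :=
  ∃ y : 𝕜, Tendsto (fun j : ℕ => W.reconstruction f j x) atTop (𝓝 y)

/-- The remainder `R_j f(x) = ∑_{l ≥ j} Q_l f(x)`, the limit of the partial sums of the series
(only used at points where the expansion converges). -/
def remainder (W : WaveletSystem 𝕜 d) (f : (Fin d → ℝ) → 𝕜) (j : ℕ) (x : Fin d → ℝ) : 𝕜 :=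
  limUnder atTop (fun n : ℕ => ∑ l ∈ Finset.Ico j n, W.detail f l x)

/-- The set `𝓔⁺(β, f)` for `β ≠ 0`. For `β > 0` it is
`{x : liminf_j log|P_j f(x)| / (j log 2) ≥ β}` and for `β < 0` it is
`{x : P_j f(x) converges and liminf_j log|R_j f(x)| / (j log 2) ≥ β}`, with `log 0 = -∞`. -/
def levelSetPlus (W : WaveletSystem 𝕜 d) (β : ℝ) (f : (Fin d → ℝ) → 𝕜) : Set (Fin d → ℝ) :=
  {x | (0 < β ∧
          (β : EReal) ≤ liminf (fun j : ℕ =>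
            ENNReal.log ‖W.reconstruction f j x‖ₑ / (((j : ℝ) * Real.log 2 : ℝ) : EReal)) atTop) ∨
       (β < 0 ∧ W.ConvergesAt f x ∧
          (β : EReal) ≤ liminf (fun j : ℕ =>
            ENNReal.log ‖W.remainder f j x‖ₑ / (((j : ℝ) * Real.log 2 : ℝ) : EReal)) atTop)}

end WaveletSystem

end

/-!
The upper bound (case `d < sp`) is a counting argument. There the exponent `β` is negative, so the
points of the level set are those where `|R_j f| ≥ 2^{β' j}` for all large `j`, for every `β' < β`.
Since only boundedly many atoms of each level are nonzero at a point, a remainder of size `2^{β' j}`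
forces a coefficient of almost that size at some level `l ≥ j`, near the point. The Besov norm
bounds the number of such coefficients by `2^{(d - sp) l - β' p j}` up to a small exponential loss
in `l - j`, and because `d < sp` the sum over `l ≥ j` is dominated by `l = j`
(`WaveletSystem.upperBoxDim_remainder_le`). This bounds the covering numbers at every scale, hence
the upper box dimension.

The lower bound exploits that packing dimension only sees a sparse sequence of scales. The function
is a lacunary wavelet series supported on the generations of a Cantor set, with levels
`a 0 < a 1 < ⋯`. If the amplitude on generation `n` is `2^{β a (n+1)}` (for `β > 0`) or
`2^{β a (n-1)}` (for `β < 0`), then `|P_j f|`, respectively `|R_j f|`, is at least a constant times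
`2^{β j}` for all `j` at the points of the Cantor set (`WaveletSystem.mem_levelSetPlus_of_pos`,
`WaveletSystem.mem_levelSetPlus_of_neg`). Infinitely often, when there are few intervals compared to
their level `a`, the next level is taken to be `L a` with `L > 1`. Between these two levels no
coefficient is spent, so the intervals may branch freely down to a scale `2^{-w a}` with
`1 < w < L`. At this scale they are more than `2^{(1 - sp - β p) w a}` in number. For `β > 0` the
possible values of `L` are limited by the amplitude `2^{β L a}` on the few intervals of level `a`,
and the requirements on `w` and `L` are compatible exactly because `s > 0` and `β p < 1 - sp`
(`exists_jumpExponents_pos`). Baire's theorem converts these covering numbers into a lower bound for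
the packing dimension (`CantorData.le_packingDim_of_frequently`). That the coefficients of the
series are the prescribed ones rests on the orthogonality of the wavelets to each other and to `V₀`
(`WaveletSystem.waveletCoeff_dyadicAtom`, `WaveletSystem.scalingCoeff_dyadicAtom`).
-/

noncomputable section

/-! ### Upper box dimension and integer points -/

theorem log_ofReal_rpow {ε : ℝ} (hε : 0 < ε) (h : ℝ) :
    ENNReal.log (ENNReal.ofReal (ε ^ (-h))) = ((h * -Real.log ε : ℝ) : EReal) := by
  rw [ENNReal.log_ofReal_of_pos (Real.rpow_pos_of_pos hε _), Real.log_rpow hε]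
  congr 1; ring

theorem eventually_neg_log_pos :
    ∀ᶠ ε : ℝ≥0 in 𝓝[>] 0, 0 < (ε : ℝ) ∧ 0 < -Real.log (ε : ℝ) := by
  have h1 : ∀ᶠ ε : ℝ≥0 in 𝓝[>] 0, ε < 1 := nhdsWithin_le_nhds (gt_mem_nhds one_pos)
  filter_upwards [h1, self_mem_nhdsWithin] with ε hε hpos
  have hpos' : 0 < (ε : ℝ) := hpos
  exact ⟨hpos', neg_pos.2 (Real.log_neg hpos' (by exact_mod_cast hε))⟩

theorem upperBoxDim_le_of_eventually {X : Type*} [PseudoEMetricSpace X] {A : Set X} {h : ℝ}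
    (H : ∀ᶠ ε : ℝ≥0 in 𝓝[>] 0,
      ((Metric.externalCoveringNumber ε A : ℕ∞) : ℝ≥0∞) ≤ ENNReal.ofReal ((ε : ℝ) ^ (-h))) :
    upperBoxDim A ≤ ENNReal.ofReal h := by
  have : limsup (fun ε : ℝ≥0 =>
      ENNReal.log ((Metric.externalCoveringNumber ε A : ℕ∞) : ℝ≥0∞) /
      ((-Real.log (ε : ℝ) : ℝ) : EReal)) (𝓝[>] 0) ≤ ((h : ℝ) : EReal) := by
    refine limsup_le_of_le (by isBoundedDefault) ?_
    filter_upwards [H, eventually_neg_log_pos] with ε hε hpos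
    rw [EReal.div_le_iff_le_mul (by exact_mod_cast hpos.2) (EReal.coe_ne_top _)]
    refine (ENNReal.log_monotone hε).trans ?_
    rw [log_ofReal_rpow hpos.1, mul_comm, EReal.coe_mul]
  unfold upperBoxDim
  refine (EReal.toENNReal_le_toENNReal this).trans ?_
  simp

theorem le_upperBoxDim_of_frequently {X : Type*} [PseudoEMetricSpace X] {A : Set X} {h : ℝ}
    (H : ∃ᶠ ε : ℝ≥0 in 𝓝[>] 0,
      ENNReal.ofReal ((ε : ℝ) ^ (-h)) ≤ ((Metric.externalCoveringNumber ε A : ℕ∞) : ℝ≥0∞)) :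
    ENNReal.ofReal h ≤ upperBoxDim A := by
  have : ((h : ℝ) : EReal) ≤ limsup (fun ε : ℝ≥0 =>
      ENNReal.log ((Metric.externalCoveringNumber ε A : ℕ∞) : ℝ≥0∞) /
      ((-Real.log (ε : ℝ) : ℝ) : EReal)) (𝓝[>] 0) := by
    refine le_limsup_of_frequently_le ?_ (by isBoundedDefault)
    refine (H.and_eventually eventually_neg_log_pos).mono ?_
    rintro ε ⟨hε, hpos⟩
    rw [EReal.le_div_iff_mul_le (by exact_mod_cast hpos.2) (EReal.coe_ne_top _)]
    refine le_trans ?_ (ENNReal.log_monotone hε)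
    rw [log_ofReal_rpow hpos.1, EReal.coe_mul]
  unfold upperBoxDim
  refine le_trans ?_ (EReal.toENNReal_le_toENNReal this)
  simp

/-- A polynomial bound on covering numbers along a dyadic sequence of radii bounds the upper box
dimension. -/
theorem upperBoxDim_le_of_dyadic {X : Type*} [PseudoEMetricSpace X] {A : Set X} {h C R : ℝ}
    {J : ℕ} (hR : 0 < R)
    (H : ∀ j ≥ J, ((Metric.externalCoveringNumber (Real.toNNReal (R * 2 ^ (-(j : ℝ)))) A : ℕ∞)
      : ℝ≥0∞) ≤ ENNReal.ofReal (C * 2 ^ (h * j))) {h' : ℝ} (hh : h < h') (h0 : 0 ≤ h) :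
    upperBoxDim A ≤ ENNReal.ofReal h' := by
  apply upperBoxDim_le_of_eventually
  have hlim : ∀ᶠ ε : ℝ in 𝓝[>] 0, |C| * (2 * R) ^ h ≤ ε ^ (-(h' - h)) := by
    have := tendsto_rpow_neg_nhdsGT_zero (y := -(h' - h)) (by linarith)
    exact this.eventually_ge_atTop _
  have hcoe : Tendsto (fun ε : ℝ≥0 => (ε : ℝ)) (𝓝[>] 0) (𝓝[>] 0) := by
    refine tendsto_nhdsWithin_iff.2 ⟨?_, ?_⟩
    · exact (NNReal.tendsto_coe.2 tendsto_id).mono_left nhdsWithin_le_nhds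
    · filter_upwards [self_mem_nhdsWithin] with ε hε
      exact_mod_cast hε
  have hsmall : ∀ᶠ ε : ℝ in 𝓝[>] 0, ε < R * 2 ^ (-(J : ℝ)) :=
    nhdsWithin_le_nhds (gt_mem_nhds (by positivity))
  filter_upwards [hcoe.eventually hlim, hcoe.eventually hsmall, self_mem_nhdsWithin]
    with ε h1 h2 hpos
  have hε : 0 < (ε : ℝ) := hpos
  -- the dyadic scale `R 2⁻ʲ ≤ ε < 2 R 2⁻ʲ`
  set j : ℕ := ⌈Real.logb 2 (R / ε)⌉₊ with hj
  have hx : (J : ℝ) < Real.logb 2 (R / ε) := by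
    rw [Real.lt_logb_iff_rpow_lt (by norm_num) (by positivity), lt_div_iff₀ hε]
    rw [Real.rpow_neg (by norm_num), ← div_eq_mul_inv, lt_div_iff₀ (by positivity)] at h2
    linarith
  have hjJ : J ≤ j := by
    have : (J : ℝ) ≤ j := hx.le.trans (Nat.le_ceil _)
    exact_mod_cast this
  have hj1 : R * 2 ^ (-(j : ℝ)) ≤ ε := by
    have : R / ε ≤ 2 ^ (j : ℝ) := by
      rw [← Real.logb_le_iff_le_rpow (by norm_num) (by positivity)]
      exact Nat.le_ceil _
    rw [Real.rpow_neg (by norm_num), ← div_eq_mul_inv, div_le_iff₀ (by positivity)]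
    rw [div_le_iff₀ hε] at this
    linarith
  have hj2 : (2 : ℝ) ^ (j : ℝ) ≤ 2 * R / ε := by
    have : (j : ℝ) ≤ Real.logb 2 (R / ε) + 1 :=
      (Nat.ceil_lt_add_one ((Nat.cast_nonneg J).trans hx.le)).le
    calc (2 : ℝ) ^ (j : ℝ) ≤ 2 ^ (Real.logb 2 (R / ε) + 1) :=
          Real.rpow_le_rpow_of_exponent_le (by norm_num) this
      _ = 2 * R / ε := by
          rw [Real.rpow_add (by norm_num), Real.rpow_logb (by norm_num) (by norm_num)
            (by positivity)]
          simp; ring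
  have hanti : Metric.externalCoveringNumber ε A ≤
      Metric.externalCoveringNumber (Real.toNNReal (R * 2 ^ (-(j : ℝ)))) A := by
    apply Metric.externalCoveringNumber_anti
    rw [Real.toNNReal_le_iff_le_coe]
    exact hj1
  refine (show ((Metric.externalCoveringNumber ε A : ℕ∞) : ℝ≥0∞) ≤ _ by
    exact_mod_cast hanti).trans ((H j hjJ).trans (ENNReal.ofReal_le_ofReal ?_))
  calc C * 2 ^ (h * j) ≤ |C| * 2 ^ (h * j) := by gcongr; exact le_abs_self C
    _ = |C| * (2 ^ (j : ℝ)) ^ h := by rw [← Real.rpow_mul (by norm_num), mul_comm h]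
    _ ≤ |C| * (2 * R / ε) ^ h := by gcongr
    _ = |C| * (2 * R) ^ h * (ε : ℝ) ^ (-h) := by
        rw [Real.div_rpow (by positivity) hε.le, Real.rpow_neg hε.le]; ring
    _ ≤ (ε : ℝ) ^ (-(h' - h)) * (ε : ℝ) ^ (-h) := by gcongr
    _ = (ε : ℝ) ^ (-h') := by rw [← Real.rpow_add hε]; ring_nf

/-- The integer points in a ball of fixed radius are boundedly many, uniformly in the centre. -/
theorem exists_finset_intVec_near (d : ℕ) (R : ℝ) : ∃ K : ℕ, ∀ y : Fin d → ℝ,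
    ∃ S : Finset (Fin d → ℤ), S.card ≤ K ∧
      ∀ k : Fin d → ℤ, ‖fun m => y m - (k m : ℝ)‖ ≤ R → k ∈ S := by
  classical
  set I : Finset (Fin d → ℤ) := Finset.Icc (fun _ => -(⌈R⌉ + 1)) (fun _ => ⌈R⌉ + 1)
  refine ⟨I.card, fun y => ⟨I.image fun z m => z m + ⌊y m⌋, Finset.card_image_le, ?_⟩⟩
  intro k hk
  rw [Finset.mem_image]
  refine ⟨fun m => k m - ⌊y m⌋, ?_, by ext m; simp⟩
  have key : ∀ m, |y m - (k m : ℝ)| ≤ R := fun m => by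
    have := norm_le_pi_norm (fun m => y m - (k m : ℝ)) m
    rw [Real.norm_eq_abs] at this
    exact this.trans hk
  simp only [I, Finset.mem_Icc, Pi.le_def]
  constructor <;> intro m <;>
  · have h1 := abs_le.1 (key m)
    have h2 := Int.floor_le (y m)
    have h3 := Int.lt_floor_add_one (y m)
    have h4 := Int.le_ceil R
    have : (-(⌈R⌉ + 1) : ℝ) ≤ (k m : ℝ) - ⌊y m⌋ ∧ (k m : ℝ) - ⌊y m⌋ ≤ ⌈R⌉ + 1 := by
      constructor <;> linarith
    first | exact_mod_cast this.1 | exact_mod_cast this.2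

theorem exists_forall_eq_zero_of_lt_norm {E F : Type*} [SeminormedAddCommGroup E] [Zero F]
    {g : E → F} (hg : HasCompactSupport g) : ∃ R : ℝ, ∀ y, R < ‖y‖ → g y = 0 := by
  obtain ⟨R, hR⟩ := hg.isCompact.isBounded.subset_closedBall 0
  refine ⟨R, fun y hy => ?_⟩
  by_contra hne
  have := hR (subset_tsupport _ (Function.mem_support.2 hne))
  rw [mem_closedBall_zero_iff] at this
  linarith

/-! ### The upper bound for the packing dimension -/

namespace WaveletSystem

variable {𝕜 : Type*} [RCLike 𝕜] {d : ℕ}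

theorem reconstruction_sub (W : WaveletSystem 𝕜 d) (f : (Fin d → ℝ) → 𝕜) {j n : ℕ} (h : j ≤ n)
    (x : Fin d → ℝ) :
    W.reconstruction f n x - W.reconstruction f j x = ∑ l ∈ Finset.Ico j n, W.detail f l x := by
  simp only [reconstruction]
  rw [Finset.sum_Ico_eq_sub _ h]; ring

theorem ConvergesAt.tendsto_remainder {W : WaveletSystem 𝕜 d} {f : (Fin d → ℝ) → 𝕜}
    {x : Fin d → ℝ} (h : W.ConvergesAt f x) (j : ℕ) :
    Tendsto (fun n => ∑ l ∈ Finset.Ico j n, W.detail f l x) atTop (𝓝 (W.remainder f j x)) := by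
  obtain ⟨y, hy⟩ := h
  have : Tendsto (fun n => ∑ l ∈ Finset.Ico j n, W.detail f l x) atTop
      (𝓝 (y - W.reconstruction f j x)) := by
    refine (hy.sub_const (W.reconstruction f j x)).congr' ?_
    filter_upwards [eventually_ge_atTop j] with n hn
    exact W.reconstruction_sub f hn x
  exact tendsto_nhds_limUnder ⟨_, this⟩

/-- If all wavelet coefficients at level `l` whose atoms may be nonzero at `x` are at most `τ`,
then `Q_l f(x)` is at most a constant times `τ`. -/
theorem exists_norm_detail_le (W : WaveletSystem 𝕜 d) (hc : ∀ i, Continuous (W.ψ i))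
    (hsupp : ∀ i, HasCompactSupport (W.ψ i)) :
    ∃ R K : ℝ, 0 < R ∧ 0 < K ∧ ∀ (f : (Fin d → ℝ) → 𝕜) (l : ℕ) (x : Fin d → ℝ) (τ : ℝ), 0 ≤ τ →
      (∀ i k, ‖fun m => (2 : ℝ) ^ (l : ℤ) * x m - (k m : ℝ)‖ ≤ R → ‖W.waveletCoeff f i l k‖ ≤ τ) →
      ‖W.detail f l x‖ ≤ K * τ := by
  have hR : ∃ R : ℝ, 0 < R ∧ ∀ i y, R < ‖y‖ → W.ψ i y = 0 := by
    have := fun i => exists_forall_eq_zero_of_lt_norm (hsupp i)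
    choose R hR using this
    obtain ⟨R', hR'⟩ := (Set.finite_range R).bddAbove
    refine ⟨max R' 1, by positivity, fun i y hy => hR i y (lt_of_le_of_lt ?_ hy)⟩
    exact (hR' (Set.mem_range_self i)).trans (le_max_left _ _)
  have hM : ∃ M : ℝ, 0 < M ∧ ∀ i y, ‖W.ψ i y‖ ≤ M := by
    have : ∀ i, ∃ M : ℝ, ∀ y, ‖W.ψ i y‖ ≤ M := fun i =>
      (hc i).bounded_above_of_compact_support (hsupp i)
    choose M hM using this
    obtain ⟨M', hM'⟩ := (Set.finite_range M).bddAbove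
    refine ⟨max M' 1, by positivity, fun i y => (hM i y).trans ?_⟩
    exact (hM' (Set.mem_range_self i)).trans (le_max_left _ _)
  obtain ⟨R, hR0, hR⟩ := hR
  obtain ⟨M, hM0, hM⟩ := hM
  obtain ⟨K, hK⟩ := exists_finset_intVec_near d R
  refine ⟨R, (2 ^ d - 1 : ℕ) * (K * M) + 1, hR0, by positivity, fun f l x τ hτ hcoef => ?_⟩
  obtain ⟨S, hSc, hS⟩ := hK (fun m => (2 : ℝ) ^ (l : ℤ) * x m)
  have h1 : ∀ i, ‖∑' k : Fin d → ℤ, W.waveletCoeff f i l k * dyadicAtom (W.ψ i) l k x‖ ≤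
      K * M * τ := fun i => by
    rw [tsum_eq_sum (s := S)]
    · calc _ ≤ ∑ k ∈ S, ‖W.waveletCoeff f i l k * dyadicAtom (W.ψ i) l k x‖ := norm_sum_le _ _
        _ ≤ ∑ k ∈ S, τ * M := by
            refine Finset.sum_le_sum fun k _ => ?_
            rw [norm_mul]
            by_cases hk : ‖fun m => (2 : ℝ) ^ (l : ℤ) * x m - (k m : ℝ)‖ ≤ R
            · exact mul_le_mul (hcoef i k hk) (hM _ _) (norm_nonneg _) hτ
            · have : dyadicAtom (W.ψ i) l k x = 0 := hR i _ (not_le.1 hk)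
              rw [this]; simp; positivity
        _ = S.card * M * τ := by simp; ring
        _ ≤ K * M * τ := by gcongr
    · intro k hk
      have : dyadicAtom (W.ψ i) l k x = 0 := hR i _ (not_le.1 fun h => hk (hS k h))
      rw [this, mul_zero]
  calc ‖W.detail f l x‖ ≤ ∑ i : Fin (2 ^ d - 1), K * M * τ := norm_sum_le_of_le _ fun i _ => h1 i
    _ = (2 ^ d - 1 : ℕ) * (K * M) * τ := by simp [mul_assoc]
    _ ≤ _ := by nlinarith

/-- The `ℓᵖ` norm of the coefficients at one level of a function in `B_p^{s,∞}`. -/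
theorem MemBesov.exists_tsum_le {W : WaveletSystem 𝕜 d} {p s : ℝ} (hp : 0 < p)
    {f : (Fin d → ℝ) → 𝕜} (hf : W.MemBesov p s ⊤ f) : ∃ C : ℝ, 0 ≤ C ∧ ∀ j : ℕ, 1 ≤ j →
      ∑' a : Fin (2 ^ d - 1) × (Fin d → ℤ), ‖W.waveletCoeff f a.1 j a.2‖ ^ p ≤
        C * 2 ^ ((d - s * p) * j) := by
  obtain ⟨C, hC⟩ := memℓp_infty_iff.1 hf.2.2.2
  have hC' : ∀ j : ℕ, 1 ≤ j → W.besovLevel p s f j ≤ C := fun j hj => by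
    obtain ⟨n, rfl⟩ : ∃ n, j = n + 1 := ⟨j - 1, by omega⟩
    exact (le_abs_self _).trans (hC ⟨n, rfl⟩)
  refine ⟨|C| ^ p, by positivity, fun j hj => ?_⟩
  set T := ∑' a : Fin (2 ^ d - 1) × (Fin d → ℤ), ‖W.waveletCoeff f a.1 j a.2‖ ^ p with hT
  have hT0 : 0 ≤ T := tsum_nonneg fun _ => by positivity
  have h1 : (2 : ℝ) ^ ((s - d / p) * j) * T ^ (1 / p) ≤ |C| := (hC' j hj).trans (le_abs_self _)
  have h2 := Real.rpow_le_rpow (by positivity) h1 hp.le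
  rw [Real.mul_rpow (by positivity) (by positivity), ← Real.rpow_mul hT0, one_div,
    inv_mul_cancel₀ hp.ne', Real.rpow_one, ← Real.rpow_mul (by norm_num)] at h2
  have h3 : (s - d / p) * j * p = -((d - s * p) * j) := by field_simp; ring
  rw [h3, Real.rpow_neg (by norm_num), inv_mul_le_iff₀ (by positivity)] at h2
  linarith

theorem encard_le_tsum {α : Type*} (U : Set α) (w : α → ℝ≥0∞) (h : ∀ a ∈ U, 1 ≤ w a) :
    ((U.encard : ℕ∞) : ℝ≥0∞) ≤ ∑' a, w a := by
  rw [← ENNReal.tsum_set_one]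
  calc ∑' _ : U, (1 : ℝ≥0∞) ≤ ∑' a : U, w a := ENNReal.tsum_le_tsum fun a => h a a.2
    _ ≤ ∑' a, w a := ENNReal.tsum_comp_le_tsum_of_injective Subtype.val_injective _

/-- For `β' < 0` the points where all remainders `R_j f`, `j ≥ J`, exceed `2^{β' j}` have upper box
dimension at most `d - sp - β' p` when `d < sp`: a large remainder at scale `j` forces a large
coefficient at some finer level `l ≥ j`, and there are few of those. -/
theorem upperBoxDim_remainder_le (W : WaveletSystem 𝕜 d) {p s : ℝ} (hp : 0 < p)
    (hc : ∀ i, Continuous (W.ψ i)) (hsupp : ∀ i, HasCompactSupport (W.ψ i))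
    (hd : (d : ℝ) - s * p < 0) {f : (Fin d → ℝ) → 𝕜} (hf : W.MemBesov p s ⊤ f) {β h : ℝ}
    (hβ0 : 0 ≤ d - s * p - β * p) (hh : d - s * p - β * p < h) {J : ℕ} (hJ : 1 ≤ J) :
    upperBoxDim {x | W.ConvergesAt f x ∧ ∀ j ≥ J, (2 : ℝ) ^ (β * j) ≤ ‖W.remainder f j x‖} ≤
      ENNReal.ofReal h := by
  obtain ⟨R, K, hR, hK, hdet⟩ := W.exists_norm_detail_le hc hsupp
  obtain ⟨C, hC0, hC⟩ := hf.exists_tsum_le hp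
  set A := {x | W.ConvergesAt f x ∧ ∀ j ≥ J, (2 : ℝ) ^ (β * j) ≤ ‖W.remainder f j x‖} with hA
  -- the tolerance for coefficients at level `j + m` is `c 2^{β j} q ^ m`, with `q < 1` so close to
  -- `1` that the number of exceedances, which is of order `(2^{d - sp} q^{-p}) ^ m`, is summable
  obtain ⟨γ, hγ0, hγ⟩ : ∃ γ : ℝ, 0 < γ ∧ (d - s * p) + γ * p < 0 :=
    ⟨(s * p - d) / (2 * p), div_pos (by linarith) (by positivity), by field_simp; linarith⟩
  set q : ℝ := 2 ^ (-γ) with hq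
  have hq0 : 0 < q := by positivity
  have hq1 : q < 1 := Real.rpow_lt_one_of_one_lt_of_neg (by norm_num) (by linarith)
  set ρ : ℝ := 2 ^ ((d - s * p) + γ * p) with hρ
  have hρ0 : 0 < ρ := by positivity
  have hρ1 : ρ < 1 := Real.rpow_lt_one_of_one_lt_of_neg (by norm_num) hγ
  -- if all relevant coefficients were within the tolerance, the remainder would be `≤ 2^{β j} / 2`
  set c : ℝ := (1 - q) / (2 * K) with hcdef
  have hc0 : 0 < c := div_pos (by linarith) (by positivity)
  refine upperBoxDim_le_of_dyadic (C := C * c ^ (-p) * (1 - ρ)⁻¹) (R := R) (J := J) hR ?_ hh hβ0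
  intro j hj
  set τ : ℕ → ℝ := fun m => c * 2 ^ (β * j) * q ^ m with hτ
  have hτ0 : ∀ m, 0 < τ m := fun m => by positivity
  set U : Set (ℕ × (Fin (2 ^ d - 1) × (Fin d → ℤ))) :=
    {a | τ a.1 < ‖W.waveletCoeff f a.2.1 (j + a.1) a.2.2‖} with hU
  have hcover : Metric.IsCover (Real.toNNReal (R * 2 ^ (-(j : ℝ)))) A
      ((fun (a : ℕ × (Fin (2 ^ d - 1) × (Fin d → ℤ))) (m : Fin d) =>
        (2 : ℝ) ^ (-((j + a.1 : ℕ) : ℤ)) * (a.2.2 m : ℝ)) '' U) := by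
    intro x hx
    by_contra hcon
    have hsmall : ∀ m, ‖W.detail f (j + m) x‖ ≤ K * τ m := fun m => by
      refine hdet f (j + m) x (τ m) (hτ0 m).le fun i k hk => ?_
      by_contra hlt
      refine hcon ⟨_, ⟨(m, i, k), not_le.1 hlt, rfl⟩, ?_⟩
      have h2 : (0 : ℝ) < 2 ^ ((j + m : ℕ) : ℤ) := by positivity
      have hdist : dist x (fun m' => (2 : ℝ) ^ (-((j + m : ℕ) : ℤ)) * (k m' : ℝ)) ≤
          R * 2 ^ (-(j : ℝ)) := by
        rw [dist_pi_le_iff (by positivity)]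
        intro m'
        have := (norm_le_pi_norm
          (fun m' => (2 : ℝ) ^ ((j + m : ℕ) : ℤ) * x m' - (k m' : ℝ)) m').trans hk
        rw [Real.norm_eq_abs] at this
        rw [Real.dist_eq]
        have e : x m' - (2 : ℝ) ^ (-((j + m : ℕ) : ℤ)) * (k m' : ℝ) =
            (2 : ℝ) ^ (-((j + m : ℕ) : ℤ)) * ((2 : ℝ) ^ ((j + m : ℕ) : ℤ) * x m' - (k m' : ℝ)) := by
          rw [zpow_neg, mul_sub, inv_mul_cancel_left₀ h2.ne']
        rw [e, abs_mul, abs_of_pos (by positivity), mul_comm R]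
        refine mul_le_mul ?_ this (abs_nonneg _) (by positivity)
        rw [← Real.rpow_intCast]
        apply Real.rpow_le_rpow_of_exponent_le (by norm_num)
        push_cast; linarith [(Nat.cast_nonneg m : (0:ℝ) ≤ m)]
      change edist _ _ ≤ _
      rw [edist_dist]
      exact ENNReal.ofReal_le_ofReal hdist
    have hle : ‖W.remainder f j x‖ ≤ 2 ^ (β * j) / 2 := by
      refine le_of_tendsto (hx.1.tendsto_remainder j).norm (Eventually.of_forall fun n => ?_)
      calc ‖∑ l ∈ Finset.Ico j n, W.detail f l x‖
          = ‖∑ m ∈ Finset.range (n - j), W.detail f (j + m) x‖ := by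
            rw [Finset.sum_Ico_eq_sum_range]
        _ ≤ ∑ m ∈ Finset.range (n - j), K * (c * 2 ^ (β * j)) * q ^ m :=
            norm_sum_le_of_le _ fun m _ => (hsmall m).trans
              (by simp only [hτ]; exact le_of_eq (by ring))
        _ = K * (c * 2 ^ (β * j)) * ∑ m ∈ Finset.range (n - j), q ^ m := by rw [Finset.mul_sum]
        _ ≤ K * (c * 2 ^ (β * j)) * (1 - q)⁻¹ := by
            gcongr
            rw [← tsum_geometric_of_lt_one hq0.le hq1]
            exact (summable_geometric_of_lt_one hq0.le hq1).sum_le_tsum _ fun _ _ => by positivity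
        _ = 2 ^ (β * j) / 2 := by
            have : 1 - q ≠ 0 := by linarith
            rw [hcdef]; field_simp
    have h3 := hx.2 j hj
    have h4 : (0 : ℝ) < 2 ^ (β * j) := by positivity
    linarith
  have hcount : ((U.encard : ℕ∞) : ℝ≥0∞) ≤
      ENNReal.ofReal (C * c ^ (-p) * (1 - ρ)⁻¹ * 2 ^ ((d - s * p - β * p) * j)) := by
    refine (encard_le_tsum U
      (fun a => ENNReal.ofReal (‖W.waveletCoeff f a.2.1 (j + a.1) a.2.2‖ ^ p * (τ a.1) ^ (-p)))
      fun a ha => ?_).trans ?_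
    · rw [← ENNReal.ofReal_one]
      apply ENNReal.ofReal_le_ofReal
      rw [Real.rpow_neg (hτ0 _).le, ← div_eq_mul_inv, one_le_div (Real.rpow_pos_of_pos (hτ0 _) _)]
      exact Real.rpow_le_rpow (hτ0 _).le (le_of_lt ha) hp.le
    · rw [ENNReal.tsum_prod']
      calc _ ≤ ∑' m : ℕ, ENNReal.ofReal
            (C * c ^ (-p) * 2 ^ ((d - s * p - β * p) * j) * ρ ^ m) := by
            refine ENNReal.tsum_le_tsum fun m => ?_
            have hsum := hf.2.2.1 (j + m) (by omega)
            dsimp only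
            rw [← ENNReal.ofReal_tsum_of_nonneg (fun a => by have := hτ0 m; positivity)
              (hsum.mul_right _), tsum_mul_right]
            apply ENNReal.ofReal_le_ofReal
            calc _ ≤ C * 2 ^ ((d - s * p) * (j + m : ℕ)) * τ m ^ (-p) :=
                  mul_le_mul_of_nonneg_right (hC _ (by omega))
                    (Real.rpow_nonneg (hτ0 m).le _)
              _ = _ := by
                have e1 : τ m = c * 2 ^ (β * j - γ * m) := by
                  simp only [hτ, hq]
                  rw [← Real.rpow_natCast, ← Real.rpow_mul (by norm_num), mul_assoc,
                    ← Real.rpow_add (by norm_num)]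
                  ring_nf
                have e2 : ρ ^ m = 2 ^ (((d - s * p) + γ * p) * m) := by
                  rw [hρ, ← Real.rpow_natCast, ← Real.rpow_mul (by norm_num)]
                rw [e1, e2, Real.mul_rpow hc0.le (by positivity), ← Real.rpow_mul (by norm_num)]
                rw [mul_assoc (C * c ^ (-p)), ← Real.rpow_add (by norm_num)]
                rw [show C * 2 ^ ((d - s * p) * (j + m : ℕ)) *
                  (c ^ (-p) * 2 ^ ((β * j - γ * m) * -p)) = C * c ^ (-p) *
                    ((2 : ℝ) ^ ((d - s * p) * (j + m : ℕ)) * 2 ^ ((β * j - γ * m) * -p)) by ring,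
                  ← Real.rpow_add (by norm_num)]
                congr 2
                push_cast; ring
        _ = _ := by
            rw [← ENNReal.ofReal_tsum_of_nonneg (fun m => by positivity)
              ((summable_geometric_of_lt_one hρ0.le hρ1).mul_left _), tsum_mul_left,
              tsum_geometric_of_lt_one hρ0.le hρ1]
            ring_nf
  refine le_trans ?_ hcount
  have := (hcover.externalCoveringNumber_le_encard).trans (Set.encard_image_le _ U)
  exact_mod_cast this

/-- The upper bound for the packing dimension in the case of continuous functions. -/
theorem packingDim_levelSetPlus_le (W : WaveletSystem 𝕜 d) {p s : ℝ} (hp : 0 < p)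
    (hc : ∀ i, Continuous (W.ψ i)) (hsupp : ∀ i, HasCompactSupport (W.ψ i))
    (hd : (d : ℝ) - s * p < 0) {f : (Fin d → ℝ) → 𝕜} (hf : W.MemBesov p s ⊤ f) {β : ℝ}
    (hβ : β < d / p - s) :
    packingDim (W.levelSetPlus β f) ≤ ENNReal.ofReal (d - s * p - β * p) := by
  have hH : 0 < d - s * p - β * p := by
    rw [lt_sub_iff_add_lt, lt_div_iff₀ hp] at hβ
    linarith
  have hβ0 : β < 0 := by
    have : β * p < 0 := by linarith
    exact neg_of_mul_neg_left this hp.le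
  refine ENNReal.le_of_forall_pos_le_add fun ε hε _ => ?_
  rw [← ENNReal.ofReal_coe_nnreal, ← ENNReal.ofReal_add hH.le ε.coe_nonneg]
  set β' : ℝ := β - ε / (2 * p) with hβ'
  have hε' : (0 : ℝ) < ε := hε
  have hβlt : β' < β := by rw [hβ']; linarith [show 0 < (ε : ℝ) / (2 * p) by positivity]
  have hβp : β' * p = β * p - ε / 2 := by rw [hβ']; field_simp
  refine iInf₂_le_of_le (fun J => {x | W.ConvergesAt f x ∧
    ∀ j ≥ J + 1, (2 : ℝ) ^ (β' * j) ≤ ‖W.remainder f j x‖}) ?_ ?_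
  · rintro x (⟨h, -⟩ | ⟨-, hconv, hlim⟩)
    · linarith
    · have hev := eventually_lt_of_lt_liminf (lt_of_lt_of_le (EReal.coe_lt_coe_iff.2 hβlt) hlim)
      obtain ⟨J, hJ⟩ := eventually_atTop.1 hev
      refine mem_iUnion.2 ⟨J, hconv, fun j hj => ?_⟩
      have hpos : 0 < (j : ℝ) * Real.log 2 := by
        have : 0 < j := by omega
        positivity
      have h1 := (hJ j (by omega)).le
      rw [EReal.le_div_iff_mul_le (by exact_mod_cast hpos) (EReal.coe_ne_top _)] at h1
      have h2 : ((β' : ℝ) : EReal) * (((j : ℝ) * Real.log 2 : ℝ) : EReal) =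
          ENNReal.log (ENNReal.ofReal (2 ^ (β' * j))) := by
        rw [ENNReal.log_ofReal_of_pos (by positivity), Real.log_rpow (by norm_num), ← EReal.coe_mul,
          mul_assoc]
      rw [h2, ENNReal.log_le_log_iff, ← ofReal_norm,
        ENNReal.ofReal_le_ofReal_iff (norm_nonneg _)] at h1
      exact h1
  · refine iSup_le fun J => W.upperBoxDim_remainder_le hp hc hsupp hd hf ?_ ?_ (by omega) <;>
    linarith

end WaveletSystem

/-! ### Orthogonality of the atoms -/

namespace WaveletSystem

variable {𝕜 : Type*} [RCLike 𝕜] {d : ℕ}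

/-- The inner products of the unnormalised atoms `ψ⁽ⁱ⁾(2^j x - k)`. -/
theorem waveletCoeff_dyadicAtom [DecidableEq (Fin (2 ^ d - 1) × ℕ × (Fin d → ℤ))]
    (W : WaveletSystem 𝕜 d) (i i' : Fin (2 ^ d - 1)) (j j' : ℕ)
    (k k' : Fin d → ℤ) :
    W.waveletCoeff (dyadicAtom (W.ψ i') j' k') i j k =
      if (i, j, k) = (i', j', k') then 1 else 0 := by
  classical
  obtain ⟨u, hu, hon, -⟩ := W.wavelet_basis
  have h1 := orthonormal_iff_ite.1 hon (i, (j : ℤ), k) (i', (j' : ℤ), k')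
  rw [L2.inner_def] at h1
  set c : ℕ → ℝ := fun j => 2 ^ ((d : ℝ) * (j : ℝ) / 2) with hc
  have hcpos : ∀ j, 0 < c j := fun j => by positivity
  have hc2 : ∀ j, c j * c j = 2 ^ (d * j) := fun j => by
    simp only [hc]
    rw [← Real.rpow_add (by norm_num), ← Real.rpow_natCast]
    congr 1; push_cast; ring
  have h2 : ∫ x, inner 𝕜 (u (i, (j : ℤ), k) x) (u (i', (j' : ℤ), k') x) =
      ∫ x, (((c j)⁻¹ * c j' : ℝ) : 𝕜) *
        ((2 : 𝕜) ^ (d * j) * conj (dyadicAtom (W.ψ i) j k x) * dyadicAtom (W.ψ i') j' k' x) := by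
    apply integral_congr_ae
    filter_upwards [hu (i, (j : ℤ), k), hu (i', (j' : ℤ), k')] with x hx hx'
    have e : (2 : 𝕜) ^ (d * j) = ((c j * c j : ℝ) : 𝕜) := by rw [hc2]; push_cast; rfl
    have hne : ((c j : ℝ) : 𝕜) ≠ 0 := by exact_mod_cast (hcpos j).ne'
    rw [hx, hx', RCLike.inner_apply, e]
    simp only [map_mul, RCLike.conj_ofReal, Int.cast_natCast]
    change (c j' : 𝕜) * _ * ((c j : 𝕜) * _) = _
    push_cast
    field_simp
  rw [h2, integral_const_mul] at h1
  change _ * W.waveletCoeff (dyadicAtom (W.ψ i') j' k') i j k = _ at h1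
  have hne : (((c j)⁻¹ * c j' : ℝ) : 𝕜) ≠ 0 := by
    have := hcpos j; have := hcpos j'
    exact_mod_cast (by positivity : (c j)⁻¹ * c j' ≠ 0)
  split_ifs with h
  · simp only [Prod.mk.injEq] at h
    obtain ⟨rfl, rfl, rfl⟩ := h
    rw [inv_mul_cancel₀ (hcpos j).ne'] at h1
    simpa using h1
  · rw [if_neg] at h1
    · exact (mul_eq_zero.1 h1).resolve_left hne
    · simpa using h

theorem V_monotone (W : WaveletSystem 𝕜 d) : Monotone W.V := monotone_int_of_le_succ W.mono

theorem memLp_comp_smul {p : ℝ≥0∞} {g : (Fin d → ℝ) → 𝕜} (hg : MemLp g p) {r : ℝ} (hr : r ≠ 0) :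
    MemLp (fun x => g (r • x)) p := by
  refine MemLp.comp_of_map (f := fun x : Fin d → ℝ => r • x) ?_
    (measurable_const_smul r).aemeasurable
  rw [Measure.map_addHaar_smul _ hr]
  exact hg.smul_measure ENNReal.ofReal_ne_top

theorem memLp_scaling (W : WaveletSystem 𝕜 d) (k : Fin d → ℤ) :
    MemLp (dyadicAtom W.φ 0 k) 2 := by
  obtain ⟨v, hv, -⟩ := W.scaling_basis
  exact (memLp_congr_ae (hv k)).1 (Lp.memLp _)

/-- The dilated scaling function `φ(2⁻ʲ x - k)` belongs to `V₋ⱼ`. -/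
theorem toLp_scaling_mem (W : WaveletSystem 𝕜 d) (k : Fin d → ℤ) (j : ℕ) :
    (memLp_comp_smul (W.memLp_scaling k) (inv_ne_zero (pow_ne_zero j (two_ne_zero' ℝ)))).toLp _ ∈
      W.V (-j) := by
  induction j with
  | zero =>
    obtain ⟨v, hv, -, hspan⟩ := W.scaling_basis
    have : v k ∈ W.V 0 := by
      rw [← hspan]
      exact Submodule.le_topologicalClosure _ (Submodule.subset_span ⟨k, rfl⟩)
    convert this using 1
    · simp
    apply Lp.ext
    filter_upwards [hv k, MemLp.coeFn_toLp (memLp_comp_smul (W.memLp_scaling k)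
      (inv_ne_zero (pow_ne_zero 0 (two_ne_zero' ℝ))))] with x h1 h2
    rw [h1, h2]
    simp
  | succ j ih =>
    have := (W.dilation (-(j + 1 : ℕ))
      ((memLp_comp_smul (W.memLp_scaling k)
        (inv_ne_zero (pow_ne_zero (j + 1) (two_ne_zero' ℝ)))).toLp _)
      ((memLp_comp_smul (W.memLp_scaling k)
        (inv_ne_zero (pow_ne_zero j (two_ne_zero' ℝ)))).toLp _) ?_).2
    · refine this ?_
      convert ih using 2
      push_cast; ring
    · have hq := Measure.quasiMeasurePreserving_smul (volume : Measure (Fin d → ℝ))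
        (two_ne_zero' ℝ)
      filter_upwards [MemLp.coeFn_toLp (memLp_comp_smul (W.memLp_scaling k)
          (inv_ne_zero (pow_ne_zero j (two_ne_zero' ℝ)))),
        hq.ae (MemLp.coeFn_toLp (memLp_comp_smul (W.memLp_scaling k)
          (inv_ne_zero (pow_ne_zero (j + 1) (two_ne_zero' ℝ)))))] with x h1 h2
      rw [h1, h2, smul_smul]
      congr 2
      rw [pow_succ]; field_simp

/-- Wavelets of nonnegative levels are orthogonal to `V₀`. -/
theorem scalingCoeff_dyadicAtom (W : WaveletSystem 𝕜 d) (i : Fin (2 ^ d - 1)) (j : ℕ)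
    (k k' : Fin d → ℤ) : W.scalingCoeff (dyadicAtom (W.ψ i) j k') k = 0 := by
  obtain ⟨v, hv, -, hspan⟩ := W.wavelet_detail_basis
  have hmem : v (i, k') ∈ W.V 1 ⊓ (W.V 0)ᗮ := by
    rw [← hspan]
    exact Submodule.le_topologicalClosure _ (Submodule.subset_span ⟨(i, k'), rfl⟩)
  have hφ := W.V_monotone (by simp : -(j : ℤ) ≤ 0) (W.toLp_scaling_mem k j)
  have h0 := Submodule.inner_right_of_mem_orthogonal hφ hmem.2
  rw [L2.inner_def] at h0
  set G : (Fin d → ℝ) → 𝕜 := fun y =>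
    conj (dyadicAtom W.φ 0 k (((2 : ℝ) ^ j)⁻¹ • y)) * dyadicAtom (W.ψ i) 0 k' y with hG
  have h1 : ∫ y, G y = 0 := by
    rw [← h0]
    apply integral_congr_ae
    filter_upwards [hv (i, k'), MemLp.coeFn_toLp (memLp_comp_smul (W.memLp_scaling k)
          (inv_ne_zero (pow_ne_zero j (two_ne_zero' ℝ))))] with x h1 h2
    rw [h1, h2, RCLike.inner_apply, mul_comm]
  have h2 : W.scalingCoeff (dyadicAtom (W.ψ i) j k') k = ∫ x, G ((2 : ℝ) ^ j • x) := by
    unfold scalingCoeff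
    congr 1
    ext x
    simp only [hG]
    rw [inv_smul_smul₀ (by positivity)]
    congr 1
    simp [dyadicAtom]
  rw [h2, Measure.integral_comp_smul, h1, smul_zero]

end WaveletSystem

/-! ### Wavelet series with prescribed coefficients -/

theorem ae_summable_of_tsum_eLpNorm_one {α 𝕜 : Type*} [MeasurableSpace α] {μ : Measure α}
    [RCLike 𝕜] {F : ℕ → α → 𝕜} (hF : ∀ n, AEStronglyMeasurable (F n) μ)
    (hsum : ∑' n, eLpNorm (F n) 1 μ ≠ ∞) : ∀ᵐ x ∂μ, Summable fun n => F n x := by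
  simp only [eLpNorm_one_eq_lintegral_enorm] at hsum
  rw [← lintegral_tsum fun n => (hF n).enorm] at hsum
  filter_upwards [ae_lt_top' (AEMeasurable.tsum fun n => (hF n).enorm) hsum] with x hx
  apply Summable.of_norm
  have := ENNReal.summable_toReal hx.ne
  simpa using this

/-- An almost everywhere convergent series whose `Lᵖ` norms are summable has its sum in `Lᵖ`, by
Fatou's lemma. -/
theorem memLp_tsum {α 𝕜 : Type*} [MeasurableSpace α] {μ : Measure α}
    [RCLike 𝕜] {F : ℕ → α → 𝕜} {p : ℝ≥0∞} (hp : 1 ≤ p)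
    (hF : ∀ n, AEStronglyMeasurable (F n) μ)
    (hs : ∀ᵐ x ∂μ, Summable fun n => F n x)
    (hsum : ∑' n, eLpNorm (F n) p μ ≠ ∞) : MemLp (fun x => ∑' n, F n x) p μ := by
  have hm : ∀ N, AEStronglyMeasurable (∑ n ∈ Finset.range N, F n) μ := fun N =>
    Finset.aestronglyMeasurable_sum _ fun n _ => hF n
  have hlim : ∀ᵐ x ∂μ, Tendsto (fun N => (∑ n ∈ Finset.range N, F n) x) atTop
      (𝓝 (∑' n, F n x)) := by
    filter_upwards [hs] with x hx
    simpa using hx.hasSum.tendsto_sum_nat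
  refine ⟨aestronglyMeasurable_of_tendsto_ae atTop hm hlim, ?_⟩
  refine lt_of_le_of_lt (Lp.eLpNorm_lim_le_liminf_eLpNorm hm _ hlim)
    (lt_of_le_of_lt ?_ (lt_top_iff_ne_top.2 hsum))
  refine liminf_le_of_le (by isBoundedDefault) fun b hb => ?_
  obtain ⟨N, hN⟩ := hb.exists
  exact hN.trans ((eLpNorm_sum_le (fun n _ => hF n) hp).trans (ENNReal.sum_le_tsum _))

namespace WaveletSystem

variable {𝕜 : Type*} [RCLike 𝕜] {d : ℕ}

/-- The wavelet polynomial `A ∑_{k ∈ S} ψ⁽ⁱ⁾(2^j x - k)` of level `j`. -/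
def atomSum (W : WaveletSystem 𝕜 d) (i : Fin (2 ^ d - 1)) (j : ℕ) (A : ℝ)
    (S : Finset (Fin d → ℤ)) (x : Fin d → ℝ) : 𝕜 :=
  (A : 𝕜) * ∑ k ∈ S, dyadicAtom (W.ψ i) j k x

theorem continuous_dyadicAtom {g : (Fin d → ℝ) → 𝕜} (hg : Continuous g) (j : ℤ)
    (k : Fin d → ℤ) : Continuous (dyadicAtom g j k) := by
  unfold dyadicAtom
  fun_prop

theorem continuous_atomSum (W : WaveletSystem 𝕜 d) {i : Fin (2 ^ d - 1)}
    (hc : Continuous (W.ψ i)) (j : ℕ) (A : ℝ) (S : Finset (Fin d → ℤ)) :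
    Continuous (W.atomSum i j A S) :=
  continuous_const.mul (continuous_finsetSum _ fun k _ => continuous_dyadicAtom hc j k)

/-- The `L^q` norm of a wavelet polynomial: at each point boundedly many terms are nonzero. -/
theorem exists_eLpNorm_atomSum_le (W : WaveletSystem 𝕜 d) {i : Fin (2 ^ d - 1)}
    (hc : Continuous (W.ψ i)) (hsupp : HasCompactSupport (W.ψ i)) :
    ∃ K V : ℝ, 0 ≤ K ∧ 0 ≤ V ∧ ∀ (q : ℝ) (j : ℕ) (A : ℝ) (S : Finset (Fin d → ℤ)), 1 ≤ q → 0 ≤ A →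
      eLpNorm (W.atomSum i j A S) (ENNReal.ofReal q) volume ≤
        ENNReal.ofReal (K * (V ^ (1 / q) * (A * (S.card * ((2 : ℝ) ^ (d * j))⁻¹) ^ (1 / q)))) := by
  obtain ⟨R, hR⟩ := exists_forall_eq_zero_of_lt_norm hsupp
  obtain ⟨M, hM⟩ : ∃ M : ℝ, ∀ y, ‖W.ψ i y‖ ≤ M := hc.bounded_above_of_compact_support hsupp
  have hM0 : 0 ≤ M := (norm_nonneg _).trans (hM 0)
  obtain ⟨K, hK⟩ := exists_finset_intVec_near d R
  refine ⟨K * M, (2 * |R|) ^ d, by positivity, by positivity, fun q j A S hq hA => ?_⟩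
  set T : Set (Fin d → ℝ) := ⋃ k ∈ S,
    Metric.closedBall (fun m => ((2 : ℝ) ^ j)⁻¹ * (k m : ℝ)) (((2 : ℝ) ^ j)⁻¹ * |R|) with hT
  have hTmeas : MeasurableSet T :=
    Finset.measurableSet_biUnion _ fun k _ => measurableSet_closedBall
  have hTvol : volume T ≤ ENNReal.ofReal ((2 * |R|) ^ d * (S.card * ((2 : ℝ) ^ (d * j))⁻¹)) := by
    refine (measure_biUnion_finset_le _ _).trans ?_
    simp only [Real.volume_pi_closedBall _ (show (0 : ℝ) ≤ ((2 : ℝ) ^ j)⁻¹ * |R| by positivity)]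
    rw [Finset.sum_const, nsmul_eq_mul, ← ENNReal.ofReal_natCast,
      ← ENNReal.ofReal_mul (by positivity)]
    apply ENNReal.ofReal_le_ofReal
    apply le_of_eq
    rw [Fintype.card_fin, mul_pow, mul_pow, mul_pow, inv_pow, ← pow_mul, mul_comm j d]
    ring
  have hzero : ∀ x, ∀ k, ¬ ‖fun m => (2 : ℝ) ^ (j : ℤ) * x m - (k m : ℝ)‖ ≤ R →
      dyadicAtom (W.ψ i) j k x = 0 := fun x k h => hR _ (not_le.1 h)
  have hbound : ∀ x, ‖W.atomSum i j A S x‖ ≤ T.indicator (fun _ => K * M * A) x := by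
    intro x
    by_cases hx : x ∈ T
    · rw [Set.indicator_of_mem hx, atomSum, norm_mul, RCLike.norm_ofReal, abs_of_nonneg hA,
        mul_comm A]
      refine mul_le_mul_of_nonneg_right ?_ hA
      obtain ⟨S', hS'c, hS'⟩ := hK (fun m => (2 : ℝ) ^ (j : ℤ) * x m)
      calc ‖∑ k ∈ S, dyadicAtom (W.ψ i) j k x‖
          ≤ ∑ k ∈ S, ‖dyadicAtom (W.ψ i) j k x‖ := norm_sum_le _ _
        _ ≤ ∑ k ∈ S', ‖dyadicAtom (W.ψ i) j k x‖ := by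
          rw [← Finset.sum_filter_ne_zero]
          refine Finset.sum_le_sum_of_subset_of_nonneg (fun k hk => ?_) fun _ _ _ => norm_nonneg _
          by_contra hk'
          exact (Finset.mem_filter.1 hk).2 (by rw [hzero x k fun h => hk' (hS' k h), norm_zero])
        _ ≤ ∑ k ∈ S', M := Finset.sum_le_sum fun k _ => hM _
        _ = S'.card * M := by simp
        _ ≤ K * M := by gcongr
    · rw [Set.indicator_of_notMem hx]
      have : ∀ k ∈ S, dyadicAtom (W.ψ i) j k x = 0 := fun k hk => by
        refine hzero x k fun h => hx (mem_iUnion₂.2 ⟨k, hk, ?_⟩)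
        rw [Metric.mem_closedBall, dist_pi_le_iff (by positivity)]
        intro m
        have := ((norm_le_pi_norm
          (fun m => (2 : ℝ) ^ (j : ℤ) * x m - (k m : ℝ)) m).trans h).trans (le_abs_self R)
        rw [Real.norm_eq_abs, zpow_natCast] at this
        have e : x m - ((2 : ℝ) ^ j)⁻¹ * (k m : ℝ) =
            ((2 : ℝ) ^ j)⁻¹ * ((2 : ℝ) ^ j * x m - (k m : ℝ)) := by
          rw [mul_sub, inv_mul_cancel_left₀ (by positivity)]
        rw [Real.dist_eq, e, abs_mul, abs_of_pos (by positivity)]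
        exact mul_le_mul_of_nonneg_left this (by positivity)
      rw [atomSum, Finset.sum_eq_zero this, mul_zero, norm_zero]
  have hq0 : 0 < q := by linarith
  calc eLpNorm (W.atomSum i j A S) (ENNReal.ofReal q) volume
      ≤ eLpNorm (T.indicator (fun _ => K * M * A)) (ENNReal.ofReal q) volume :=
        eLpNorm_mono_real hbound
    _ ≤ ‖K * M * A‖ₑ * volume T ^ (1 / (ENNReal.ofReal q).toReal) :=
        eLpNorm_indicator_const_le _ _
    _ ≤ ENNReal.ofReal (K * M * A) *
        ENNReal.ofReal (((2 * |R|) ^ d * (S.card * ((2 : ℝ) ^ (d * j))⁻¹)) ^ (1 / q)) := by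
      rw [ENNReal.toReal_ofReal hq0.le, ← ENNReal.ofReal_rpow_of_nonneg (by positivity)
        (by positivity), Real.enorm_eq_ofReal (by positivity)]
      gcongr
    _ = _ := by
      rw [← ENNReal.ofReal_mul (by positivity), Real.mul_rpow (by positivity) (by positivity)]
      congr 1; ring

/-- A lacunary wavelet series with prescribed coefficients: on level `a n` the coefficients equal
`A n` on a finite set `S n` of translations, all others vanish. It lies in `B_p^{s,1}` as soon as
the weighted `ℓᵖ` norms of its levels are summable. -/
theorem exists_memBesov_of_summable (W : WaveletSystem 𝕜 d) {p s : ℝ} (hp : 1 ≤ p) (hs : 0 ≤ s)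
    {i : Fin (2 ^ d - 1)} (hc : Continuous (W.ψ i)) (hsupp : HasCompactSupport (W.ψ i))
    {a : ℕ → ℕ} (ha : StrictMono a) {A : ℕ → ℝ} (hA : ∀ n, 0 ≤ A n)
    {S : ℕ → Finset (Fin d → ℤ)} (hS : ∀ n, ((S n).card : ℝ) ≤ 2 ^ (d * a n))
    (hsum : Summable fun n => (2 : ℝ) ^ ((s - d / p) * a n) * (A n * ((S n).card : ℝ) ^ (1 / p))) :
    ∃ f : (Fin d → ℝ) → 𝕜, W.MemBesov p s 1 f ∧ (∀ k, W.scalingCoeff f k = 0) ∧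
      (∀ j, j ∉ Set.range a → ∀ x, W.detail f j x = 0) ∧
      (∀ n x, W.detail f (a n) x = W.atomSum i (a n) (A n) (S n) x) := by
  classical
  have hp0 : 0 < p := by linarith
  set F : ℕ → (Fin d → ℝ) → 𝕜 := fun n => W.atomSum i (a n) (A n) (S n) with hF
  have hFc : ∀ n, Continuous (F n) := fun n => W.continuous_atomSum hc _ _ _
  obtain ⟨K, V, hK, hV, hnorm⟩ := W.exists_eLpNorm_atomSum_le hc hsupp
  have hr0 : ∀ n, 0 ≤ ((S n).card : ℝ) * ((2 : ℝ) ^ (d * a n))⁻¹ := fun n => by positivity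
  have hr1 : ∀ n, ((S n).card : ℝ) * ((2 : ℝ) ^ (d * a n))⁻¹ ≤ 1 := fun n => by
    rw [← div_eq_mul_inv]; exact div_le_one_of_le₀ (hS n) (by positivity)
  have hsump : Summable fun n => A n * ((S n).card * ((2 : ℝ) ^ (d * a n))⁻¹) ^ (1 / p) := by
    refine Summable.of_nonneg_of_le (fun n => mul_nonneg (hA n) (Real.rpow_nonneg (hr0 n) _))
      (fun n => ?_) hsum
    rw [Real.mul_rpow (by positivity) (by positivity), ← mul_assoc, mul_comm]
    refine mul_le_mul_of_nonneg_right ?_ (mul_nonneg (hA n) (by positivity))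
    rw [← Real.rpow_natCast, ← Real.rpow_neg (by norm_num), ← Real.rpow_mul (by norm_num)]
    apply Real.rpow_le_rpow_of_exponent_le (by norm_num)
    have : 0 ≤ s * a n := by positivity
    have e : -((d * a n : ℕ) : ℝ) * (1 / p) = -(d / p) * a n := by push_cast; ring
    rw [e]; linarith
  have hsum1 : Summable fun n => A n * ((S n).card * ((2 : ℝ) ^ (d * a n))⁻¹) ^ (1 / (1 : ℝ)) := by
    refine Summable.of_nonneg_of_le (fun n => mul_nonneg (hA n) (Real.rpow_nonneg (hr0 n) _))
      (fun n => ?_) hsump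
    refine mul_le_mul_of_nonneg_left ?_ (hA n)
    rcases (hr0 n).eq_or_lt with h | h
    · rw [← h, Real.zero_rpow (by simp), Real.zero_rpow (by positivity)]
    · exact Real.rpow_le_rpow_of_exponent_ge h (hr1 n)
        (by rw [one_div_le_one_div hp0 one_pos]; exact hp)
  have htop : ∀ q : ℝ, 1 ≤ q →
      (Summable fun n => A n * ((S n).card * ((2 : ℝ) ^ (d * a n))⁻¹) ^ (1 / q)) →
      ∑' n, eLpNorm (F n) (ENNReal.ofReal q) volume ≠ ∞ := fun q hq hsumq => by
    refine ne_top_of_le_ne_top ?_ 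
      (ENNReal.tsum_le_tsum fun n => hnorm q (a n) (A n) (S n) hq (hA n))
    exact (((hsumq.mul_left _).mul_left _)).tsum_ofReal_ne_top
  have h1 := htop 1 le_rfl hsum1
  have hpp := htop p hp hsump
  rw [ENNReal.ofReal_one] at h1
  have hFm : ∀ n, AEStronglyMeasurable (F n) volume := fun n => (hFc n).aestronglyMeasurable
  have hae := ae_summable_of_tsum_eLpNorm_one hFm h1
  have hFint : ∀ n, Integrable (F n) := fun n => by
    rw [← memLp_one_iff_integrable]
    exact ⟨hFm n, lt_top_iff_ne_top.2 (ENNReal.ne_top_of_tsum_ne_top h1 n)⟩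
  have hFnorm : Summable fun n => ∫ x, ‖F n x‖ := by
    have := ENNReal.summable_toReal h1
    refine this.congr fun n => ?_
    rw [eLpNorm_one_eq_lintegral_enorm, integral_norm_eq_lintegral_enorm (hFm n)]
  -- pairing with a bounded function commutes with the series
  have hpair : ∀ g : (Fin d → ℝ) → 𝕜, AEStronglyMeasurable g volume → (∃ C, ∀ x, ‖g x‖ ≤ C) →
      ∫ x, g x * ∑' n, F n x = ∑' n, ∑ k ∈ S n, (A n : 𝕜) *
        ∫ x, g x * dyadicAtom (W.ψ i) (a n) k x := by
    rintro g hg ⟨C, hC⟩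
    have hint : ∀ {h : (Fin d → ℝ) → 𝕜}, Integrable h → Integrable fun x => g x * h x :=
      fun {h} hh => hh.bdd_mul hg (Eventually.of_forall hC)
    have := hasSum_integral_of_summable_integral_norm (F := fun n x => g x * F n x)
      (fun n => hint (hFint n)) ?_
    · simp only [tsum_mul_left] at this
      rw [← this.tsum_eq]
      congr 1; ext n
      have hat : ∀ k, Integrable (dyadicAtom (W.ψ i) (a n) k) := fun k => by
        refine (continuous_dyadicAtom hc _ _).integrable_of_hasCompactSupport ?_
        exact hsupp.comp_homeomorph
          ((Homeomorph.smulOfNeZero ((2 : ℝ) ^ ((a n : ℕ) : ℤ)) (by positivity)).trans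
            (Homeomorph.subRight fun m => (k m : ℝ)))
      simp only [← integral_const_mul]
      rw [← integral_finsetSum _ fun k _ => (hint (hat k)).const_mul _]
      refine integral_congr_ae (Eventually.of_forall fun x => ?_)
      simp only [hF, atomSum, Finset.mul_sum]
      exact Finset.sum_congr rfl fun k _ => by ring
    · refine Summable.of_nonneg_of_le (fun n => integral_nonneg fun x => norm_nonneg _)
        (fun n => ?_) (hFnorm.mul_left C)
      rw [← integral_const_mul]
      refine integral_mono (hint (hFint n)).norm ((hFint n).norm.const_mul C) fun x => ?_
      rw [norm_mul]
      exact mul_le_mul_of_nonneg_right (hC x) (norm_nonneg _)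
  set f : (Fin d → ℝ) → 𝕜 := fun x => ∑' n, F n x with hf
  have hatom : ∀ i' j k, ∃ C, ∀ x, ‖dyadicAtom (W.ψ i') j k x‖ ≤ C := fun i' j k => by
    obtain ⟨C, hC⟩ := W.wavelet_decay i' 0
    exact ⟨C, fun x => (hC fun m => (2 : ℝ) ^ j * x m - (k m : ℝ)).trans (by simp)⟩
  have hatomm : ∀ i' (j : ℕ) k, AEStronglyMeasurable (dyadicAtom (W.ψ i') j k) volume := by
    intro i' j k
    obtain ⟨u, hu, -⟩ := W.wavelet_basis
    have h := (Lp.aestronglyMeasurable (u (i', (j : ℤ), k))).congr (hu (i', (j : ℤ), k))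
    have hne : (((2 : ℝ) ^ ((d : ℝ) * ((j : ℤ) : ℝ) / 2) : ℝ) : 𝕜) ≠ 0 := by
      exact_mod_cast (by positivity : ((2 : ℝ) ^ ((d : ℝ) * ((j : ℤ) : ℝ) / 2)) ≠ 0)
    refine (h.const_mul (((2 : ℝ) ^ ((d : ℝ) * ((j : ℤ) : ℝ) / 2) : ℝ) : 𝕜)⁻¹).congr
      (Eventually.of_forall fun x => ?_)
    exact inv_mul_cancel_left₀ hne _
  have hwc : ∀ i' (j : ℕ) k, W.waveletCoeff f i' j k = ∑' n, ∑ k' ∈ S n, (A n : 𝕜) *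
      (if (i', j, k) = (i, a n, k') then 1 else 0) := by
    intro i' j k
    obtain ⟨C, hC⟩ := hatom i' j k
    unfold waveletCoeff
    rw [hpair (fun x => (2 : 𝕜) ^ (d * j) * conj (dyadicAtom (W.ψ i') j k x))
      ((RCLike.continuous_conj.comp_aestronglyMeasurable (hatomm i' j k)).const_mul _)
      ⟨2 ^ (d * j) * C, fun x => ?_⟩]
    · refine tsum_congr fun n => Finset.sum_congr rfl fun k' _ => ?_
      rw [← W.waveletCoeff_dyadicAtom]
      rfl
    · rw [norm_mul, RCLike.norm_conj, norm_pow, RCLike.norm_two]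
      exact mul_le_mul_of_nonneg_left (hC x) (by positivity)
  have hwc0 : ∀ i' j k, j ∉ Set.range a → W.waveletCoeff f i' j k = 0 := fun i' j k hj => by
    rw [hwc]
    refine (tsum_congr fun n => Finset.sum_eq_zero fun k' _ => ?_).trans tsum_zero
    rw [if_neg, mul_zero]
    simp only [Prod.mk.injEq, not_and]
    rintro - rfl
    exact absurd ⟨n, rfl⟩ hj
  have hwc1 : ∀ i' n k, W.waveletCoeff f i' (a n) k =
      if i' = i ∧ k ∈ S n then (A n : 𝕜) else 0 := fun i' n k => by
    rw [hwc, tsum_eq_single n]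
    · simp only [Prod.mk.injEq, true_and, mul_ite, mul_one, mul_zero]
      by_cases h : i' = i <;> simp [h]
    · refine fun n' hn' => Finset.sum_eq_zero fun k' _ => ?_
      rw [if_neg, mul_zero]
      simp only [Prod.mk.injEq, not_and]
      exact fun _ h => absurd (ha.injective h).symm hn'
  have hsc : ∀ k, W.scalingCoeff f k = 0 := fun k => by
    obtain ⟨C, hC⟩ := W.scaling_decay 0
    unfold scalingCoeff
    rw [hpair (fun x => conj (dyadicAtom W.φ 0 k x))
      (RCLike.continuous_conj.comp_aestronglyMeasurable (W.memLp_scaling k).1)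
      ⟨C, fun x => by
        rw [RCLike.norm_conj]
        exact (hC fun m => (2 : ℝ) ^ (0 : ℤ) * x m - (k m : ℝ)).trans (by simp)⟩]
    refine (tsum_congr fun n => Finset.sum_eq_zero fun k' _ => ?_).trans tsum_zero
    have := W.scalingCoeff_dyadicAtom i (a n) k k'
    rw [scalingCoeff] at this
    rw [this, mul_zero]
  have hlev0 : ∀ j, j ∉ Set.range a → W.besovLevel p s f j = 0 := fun j hj => by
    simp only [besovLevel, hwc0 _ j _ hj, norm_zero, Real.zero_rpow hp0.ne', tsum_zero]
    rw [Real.zero_rpow (by positivity), mul_zero]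
  have hfin : ∀ n, ∀ b : Fin (2 ^ d - 1) × (Fin d → ℤ), b ∉ ({i} : Finset _) ×ˢ S n →
      ‖W.waveletCoeff f b.1 (a n) b.2‖ ^ p = 0 := fun n b hb => by
    rw [Finset.mem_product, Finset.mem_singleton] at hb
    rw [hwc1, if_neg hb, norm_zero, Real.zero_rpow hp0.ne']
  have hlev1 : ∀ n, W.besovLevel p s f (a n) =
      (2 : ℝ) ^ ((s - d / p) * a n) * (A n * ((S n).card : ℝ) ^ (1 / p)) := fun n => by
    rw [besovLevel, tsum_eq_sum (s := ({i} : Finset _) ×ˢ S n) fun b hb => hfin n b hb]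
    have : ∑ b ∈ ({i} : Finset (Fin (2 ^ d - 1))) ×ˢ S n,
        ‖W.waveletCoeff f b.1 (a n) b.2‖ ^ p = (S n).card * A n ^ p := by
      rw [Finset.sum_congr rfl (g := fun _ => A n ^ p)]
      · simp
      · rintro ⟨i', k⟩ hb
        rw [Finset.mem_product, Finset.mem_singleton] at hb
        rw [hwc1, if_pos hb, RCLike.norm_ofReal, abs_of_nonneg (hA n)]
    rw [this, Real.mul_rpow (by positivity) (Real.rpow_nonneg (hA n) _), ← Real.rpow_mul (hA n),
      mul_one_div_cancel hp0.ne', Real.rpow_one, mul_comm (A n)]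
  refine ⟨f, ⟨memLp_tsum (by simpa using hp) hFm hae hpp, ?_, ?_, ?_⟩, hsc, ?_, ?_⟩
  · simp only [hsc]
    exact zero_memℓp
  · intro j _
    by_cases hj : j ∈ Set.range a
    · obtain ⟨n, rfl⟩ := hj
      exact summable_of_ne_finset_zero fun b hb => hfin n b hb
    · simp only [hwc0 _ j _ hj, norm_zero, Real.zero_rpow hp0.ne']
      exact summable_zero
  · have : Summable fun j => W.besovLevel p s f j := by
      rw [← ha.injective.summable_iff fun j hj => hlev0 j hj]
      exact hsum.congr fun n => (hlev1 n).symm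
    rw [memℓp_gen_iff (by simp)]
    simpa using ((summable_nat_add_iff 1).2 this).abs
  · intro j hj x
    simp [detail, hwc0 _ j _ hj]
  · intro n x
    simp only [detail, hwc1]
    rw [Finset.sum_eq_single i (fun i' _ hi' => by simp [hi']) (by simp),
      tsum_eq_sum (s := S n) (fun k hk => by simp [hk]), atomSum, Finset.mul_sum]
    exact Finset.sum_congr rfl fun k hk => by simp [hk]

end WaveletSystem

/-! ### Cantor sets on the line -/

/-- The combinatorial data of a Cantor set on the line. Its generation `n` consists of intervals
`2^{-a n} (k + [y, y + ρ])`, `k ∈ ℤ`; each of them contains `M n` intervals of the next generation,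
whose left endpoints are `2^{-b n}` apart. -/
structure CantorData where
  /-- the dyadic level of the generations -/
  a : ℕ → ℕ
  /-- the dyadic level of the gaps between siblings -/
  b : ℕ → ℕ
  /-- the number of children -/
  M : ℕ → ℕ
  /-- the left endpoint of the reference interval -/
  y : ℝ
  /-- the length of the reference interval -/
  ρ : ℝ
  /-- the separation constant -/
  D : ℕ
  ρ_pos : 0 < ρ
  ρ_le : ρ ≤ 1
  two_le_D : 2 ≤ D
  D_le : 4 ≤ (2 : ℝ) ^ D * ρ
  M_pos : ∀ n, 0 < M n
  b_add_le : ∀ n, b n + D ≤ a (n + 1)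
  a_le : ∀ n, a n ≤ b n
  M_le : ∀ n, (M n : ℝ) * 2 ^ a n ≤ 2 ^ b n * (ρ / 2)

namespace CantorData

variable (c : CantorData)

theorem a_add_le (n : ℕ) : c.a n + c.D ≤ c.a (n + 1) :=
  (Nat.add_le_add_right (c.a_le n) _).trans (c.b_add_le n)

theorem strictMono_a : StrictMono c.a :=
  strictMono_nat_of_lt_succ fun n => by have := c.a_add_le n; have := c.two_le_D; omega

/-- The integer indexing the child number `t` of the interval of generation `n` indexed by `k`. -/
def child (n : ℕ) (k : ℤ) (t : ℕ) : ℤ :=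
  ⌈(2 : ℝ) ^ (c.a (n + 1) - c.a n) * (k + c.y) - c.y⌉ + t * 2 ^ (c.a (n + 1) - c.b n)

theorem le_child (n : ℕ) (k : ℤ) (t : ℕ) :
    (2 : ℝ) ^ (c.a (n + 1) - c.a n) * (k + c.y) ≤ c.child n k t + c.y := by
  have h := Int.le_ceil ((2 : ℝ) ^ (c.a (n + 1) - c.a n) * (k + c.y) - c.y)
  have h2 : (0 : ℝ) ≤ t * 2 ^ (c.a (n + 1) - c.b n) := by positivity
  unfold child
  push_cast
  linarith

theorem child_le (n : ℕ) (k : ℤ) {t : ℕ} (ht : t < c.M n) :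
    c.child n k t + c.y + c.ρ ≤ (2 : ℝ) ^ (c.a (n + 1) - c.a n) * (k + c.y + c.ρ) := by
  have h := Int.ceil_lt_add_one ((2 : ℝ) ^ (c.a (n + 1) - c.a n) * (k + c.y) - c.y)
  have hD : 4 ≤ (2 : ℝ) ^ (c.a (n + 1) - c.a n) * c.ρ := by
    refine c.D_le.trans (mul_le_mul_of_nonneg_right ?_ c.ρ_pos.le)
    exact pow_le_pow_right₀ (by norm_num) (by have := c.a_add_le n; omega)
  have h2 : (t : ℝ) * 2 ^ (c.a (n + 1) - c.b n) ≤ 2 ^ (c.a (n + 1) - c.a n) * (c.ρ / 2) := by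
    have h3 : (t : ℝ) ≤ c.M n := by exact_mod_cast ht.le
    have h4 := c.M_le n
    have e : (2 : ℝ) ^ (c.a (n + 1) - c.a n) = 2 ^ (c.a (n + 1) - c.b n) * 2 ^ (c.b n - c.a n) := by
      rw [← pow_add]; congr 1; have := c.a_le n; have := c.b_add_le n; omega
    have e2 : (2 : ℝ) ^ c.b n = 2 ^ (c.b n - c.a n) * 2 ^ c.a n := by
      rw [← pow_add]; congr 1; have := c.a_le n; omega
    have h5 : (t : ℝ) ≤ 2 ^ (c.b n - c.a n) * (c.ρ / 2) := by
      have hpos : (0 : ℝ) < 2 ^ c.a n := by positivity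
      rw [e2, mul_right_comm] at h4
      exact h3.trans (le_of_mul_le_mul_right h4 hpos)
    rw [e, mul_assoc, mul_comm]
    exact mul_le_mul_of_nonneg_left h5 (by positivity)
  unfold child
  push_cast
  have := c.ρ_le
  linarith

/-- The set of integers indexing the intervals of generation `n`. -/
def nodes : ℕ → Finset ℤ
  | 0 => {0}
  | n + 1 => (nodes n ×ˢ Finset.range (c.M n)).image fun q => c.child n q.1 q.2

theorem card_nodes_le (n : ℕ) : (c.nodes n).card ≤ ∏ i ∈ Finset.range n, c.M i := by
  induction n with
  | zero => simp [nodes]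
  | succ n ih =>
    rw [Finset.prod_range_succ, nodes]
    refine Finset.card_image_le.trans ?_
    rw [Finset.card_product, Finset.card_range]
    exact Nat.mul_le_mul_right _ ih

theorem child_sub_child (n : ℕ) (k : ℤ) (t t' : ℕ) :
    c.child n k t - c.child n k t' = (t - t') * 2 ^ (c.a (n + 1) - c.b n) := by
  unfold child; ring

theorem le_abs_child_sub (n : ℕ) (k : ℤ) {t t' : ℕ} (h : t ≠ t') :
    (2 : ℤ) ^ (c.a (n + 1) - c.b n) ≤ |c.child n k t - c.child n k t'| := by
  rw [child_sub_child, abs_mul, abs_of_pos (by positivity : (0 : ℤ) < 2 ^ (c.a (n + 1) - c.b n))]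
  refine le_mul_of_one_le_left (by positivity) (Int.one_le_abs ?_)
  rw [sub_ne_zero]
  exact_mod_cast h

/-- Distinct intervals of one generation are far apart relative to their length, so that the
supports of the atoms sitting on them are disjoint when `D` is large. -/
theorem nodes_separated (n : ℕ) : ∀ k ∈ c.nodes n, ∀ k' ∈ c.nodes n, k ≠ k' →
    (2 : ℤ) ^ c.D ≤ |k - k'| := by
  induction n with
  | zero =>
    intro k hk k' hk' h
    rw [nodes, Finset.mem_singleton] at hk hk'
    exact absurd (hk.trans hk'.symm) h
  | succ n ih =>
    intro k hk k' hk' h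
    simp only [nodes, Finset.mem_image, Finset.mem_product, Finset.mem_range, Prod.exists] at hk hk'
    obtain ⟨q, t, ⟨hq, ht⟩, rfl⟩ := hk
    obtain ⟨q', t', ⟨hq', ht'⟩, rfl⟩ := hk'
    by_cases hqq : q = q'
    · subst hqq
      have htt : t ≠ t' := fun e => h (by rw [e])
      refine le_trans ?_ (c.le_abs_child_sub n q htt)
      exact pow_le_pow_right₀ (by norm_num) (by have := c.b_add_le n; omega)
    · have hsep : (2 : ℝ) ^ c.D ≤ |(q : ℝ) - q'| := by exact_mod_cast ih q hq q' hq' hqq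
      set P : ℝ := (2 : ℝ) ^ (c.a (n + 1) - c.a n) with hP
      have hP2 : (2 : ℝ) ≤ P := by
        calc (2 : ℝ) = 2 ^ 1 := by norm_num
          _ ≤ P := pow_le_pow_right₀ (by norm_num)
            (by have := c.a_add_le n; have := c.two_le_D; omega)
      have hD : (2 : ℝ) ≤ 2 ^ c.D := by
        calc (2 : ℝ) = 2 ^ 1 := by norm_num
          _ ≤ _ := pow_le_pow_right₀ (by norm_num) (by have := c.two_le_D; omega)
      have h1 := c.le_child n q t
      have h2 := c.child_le n q ht
      have h1' := c.le_child n q' t'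
      have h2' := c.child_le n q' ht'
      have hρ : P * c.ρ ≤ P := mul_le_of_le_one_right (by linarith) c.ρ_le
      have hρ0 := c.ρ_pos
      rw [← hP] at h1 h2 h1' h2'
      have h3 : |P * ((q : ℝ) - q') - ((c.child n q t : ℝ) - c.child n q' t')| ≤ P := by
        rw [abs_le]; constructor <;> linarith
      have h4 : P * |(q : ℝ) - q'| - |(c.child n q t : ℝ) - c.child n q' t'| ≤ P := by
        rw [← abs_of_pos (show 0 < P by linarith), ← abs_mul, abs_of_pos (show 0 < P by linarith)]
        exact (abs_sub_abs_le_abs_sub _ _).trans h3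
      have h5 : (2 : ℝ) ^ c.D ≤ |(c.child n q t : ℝ) - c.child n q' t'| := by nlinarith
      exact_mod_cast h5

/-- The integer indexing the interval of generation `n` on the branch `t`. -/
def index (t : ∀ n, Fin (c.M n)) : ℕ → ℤ
  | 0 => 0
  | n + 1 => c.child n (index t n) (t n)

theorem index_mem (t : ∀ n, Fin (c.M n)) (n : ℕ) : c.index t n ∈ c.nodes n := by
  induction n with
  | zero => simp [index, nodes]
  | succ n ih =>
    simp only [nodes, Finset.mem_image, Finset.mem_product, Finset.mem_range, Prod.exists]
    exact ⟨_, _, ⟨ih, (t n).2⟩, rfl⟩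

theorem index_congr {t t' : ∀ n, Fin (c.M n)} {n : ℕ} (h : ∀ i < n, t i = t' i) :
    c.index t n = c.index t' n := by
  induction n with
  | zero => rfl
  | succ n ih => simp only [index, ih fun i hi => h i (by omega), h n (by omega)]

/-- The left endpoint of the interval of generation `n` on the branch `t`. -/
def left (t : ∀ n, Fin (c.M n)) (n : ℕ) : ℝ := (c.index t n + c.y) / 2 ^ c.a n

theorem antitone_Icc (t : ∀ n, Fin (c.M n)) :
    Antitone fun n => Icc (c.left t n) (c.left t n + c.ρ / 2 ^ c.a n) := by
  refine antitone_nat_of_succ_le fun n => Icc_subset_Icc ?_ ?_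
  all_goals
    have e : (2 : ℝ) ^ c.a (n + 1) = 2 ^ (c.a (n + 1) - c.a n) * 2 ^ c.a n := by
      rw [← pow_add]; congr 1; have := c.a_add_le n; omega
    have hpos : (0 : ℝ) < 2 ^ c.a n := by positivity
    have hpos' : (0 : ℝ) < 2 ^ (c.a (n + 1) - c.a n) := by positivity
  · have := c.le_child n (c.index t n) (t n)
    unfold left
    rw [e, div_le_div_iff₀ hpos (by positivity)]
    change _ ≤ ((c.child n (c.index t n) (t n) : ℝ) + c.y) * _
    nlinarith
  · have := c.child_le n (c.index t n) (t n).2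
    unfold left
    rw [← add_div, ← add_div, e, div_le_div_iff₀ (by positivity) hpos]
    change ((c.child n (c.index t n) (t n) : ℝ) + c.y + c.ρ) * _ ≤ _
    nlinarith

/-- The point of the Cantor set on the branch `t`. -/
def point (t : ∀ n, Fin (c.M n)) : ℝ := ⨆ n, c.left t n

theorem point_mem (t : ∀ n, Fin (c.M n)) (n : ℕ) :
    c.point t ∈ Icc (c.left t n) (c.left t n + c.ρ / 2 ^ c.a n) := by
  have := ciSup_mem_iInter_Icc_of_antitone_Icc (c.antitone_Icc t)
    (fun n => by have := c.ρ_pos; linarith [show 0 < c.ρ / 2 ^ c.a n by positivity])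
  exact mem_iInter.1 this n

theorem scaled_point_mem (t : ∀ n, Fin (c.M n)) (n : ℕ) :
    (2 : ℝ) ^ c.a n * c.point t - c.index t n ∈ Icc c.y (c.y + c.ρ) := by
  have h := c.point_mem t n
  have hpos : (0 : ℝ) < 2 ^ c.a n := by positivity
  unfold left at h
  rw [← add_div] at h
  have h1 := (div_le_iff₀ hpos).1 h.1
  have h2 := (le_div_iff₀ hpos).1 h.2
  constructor <;> linarith

theorem le_abs_point_sub {t t' : ∀ n, Fin (c.M n)} {n : ℕ} (h : ∀ i < n, t i = t' i)
    (hn : t n ≠ t' n) : (2 ^ c.b n)⁻¹ / 2 ≤ |c.point t - c.point t'| := by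
  have h1 := c.scaled_point_mem t (n + 1)
  have h2 := c.scaled_point_mem t' (n + 1)
  have h3 : (2 : ℝ) ^ (c.a (n + 1) - c.b n) ≤ |(c.index t (n + 1) : ℝ) - c.index t' (n + 1)| := by
    have := c.le_abs_child_sub n (c.index t n) (t := t n) (t' := t' n)
      (fun e => hn (Fin.ext e))
    have e : c.index t' (n + 1) = c.child n (c.index t n) (t' n) := by
      rw [c.index_congr h]; rfl
    rw [e]
    exact_mod_cast this
  have hQ : (2 : ℝ) ≤ 2 ^ (c.a (n + 1) - c.b n) := by
    calc (2 : ℝ) = 2 ^ 1 := by norm_num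
      _ ≤ _ := pow_le_pow_right₀ (by norm_num)
        (by have := c.b_add_le n; have := c.two_le_D; omega)
  have e : (2 : ℝ) ^ c.a (n + 1) = 2 ^ (c.a (n + 1) - c.b n) * 2 ^ c.b n := by
    rw [← pow_add]; congr 1; have := c.b_add_le n; omega
  have hρ := c.ρ_le
  have h4 : |(2 : ℝ) ^ c.a (n + 1) * (c.point t - c.point t') -
      ((c.index t (n + 1) : ℝ) - c.index t' (n + 1))| ≤ 1 := by
    rw [abs_le]; constructor <;> linarith [h1.1, h1.2, h2.1, h2.2]
  have h5 : (2 : ℝ) ^ (c.a (n + 1) - c.b n) / 2 ≤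
      2 ^ c.a (n + 1) * |c.point t - c.point t'| := by
    have := abs_sub_abs_le_abs_sub ((c.index t (n + 1) : ℝ) - c.index t' (n + 1))
      ((2 : ℝ) ^ c.a (n + 1) * (c.point t - c.point t'))
    rw [abs_sub_comm _ ((2 : ℝ) ^ c.a (n + 1) * _), abs_mul,
      abs_of_pos (by positivity : (0 : ℝ) < 2 ^ c.a (n + 1))] at this
    linarith
  rw [e, mul_assoc, div_eq_mul_inv] at h5
  have h6 := le_of_mul_le_mul_left h5 (by positivity)
  rw [div_le_iff₀ (by norm_num), inv_le_iff_one_le_mul₀ (by positivity)]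
  linarith

theorem continuous_index (n : ℕ) : Continuous fun t => c.index t n := by
  induction n with
  | zero => exact continuous_const
  | succ n ih =>
    have h1 : Continuous fun q : ℤ × Fin (c.M n) => c.child n q.1 q.2 :=
      continuous_of_discreteTopology
    have h2 : Continuous fun t : ∀ n, Fin (c.M n) => (c.index t n, t n) :=
      ih.prodMk (continuous_apply n)
    have h3 := h1.comp h2
    have e : (fun t => c.index t (n + 1)) =
      (fun q : ℤ × Fin (c.M n) => c.child n q.1 q.2) ∘ fun t => (c.index t n, t n) := rfl
    rw [e]
    exact h3

theorem continuous_point : Continuous c.point := by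
  refine continuous_of_uniform_approx_of_continuous fun u hu => ?_
  obtain ⟨ε, hε, hu⟩ := Metric.mem_uniformity_dist.1 hu
  obtain ⟨n, hn⟩ := exists_pow_lt_of_lt_one hε (by norm_num : (1 / 2 : ℝ) < 1)
  refine ⟨fun t => c.left t n, ?_, fun t => hu ?_⟩
  · unfold left
    have : Continuous fun t => (c.index t n : ℝ) :=
      continuous_of_discreteTopology.comp (c.continuous_index n)
    fun_prop
  · have h := c.point_mem t n
    rw [Real.dist_eq, abs_of_nonneg (by linarith [h.1])]
    calc c.point t - c.left t n ≤ c.ρ / 2 ^ c.a n := by linarith [h.2]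
      _ ≤ 1 / 2 ^ n := by
        have := c.ρ_pos
        gcongr
        · exact c.ρ_le
        · norm_num
        · exact c.strictMono_a.le_apply
      _ < ε := by rwa [one_div_pow] at hn

/-- Lower bound for the packing dimension of the Cantor set, by Baire's theorem: if infinitely
often the `M n` siblings, which are `2^{-b n}` apart, are at least `2^{h b n}` up to a constant,
then any cover has a piece which is dense in a cylinder and so has upper box dimension at
least `h`. -/
theorem le_packingDim_of_frequently {h : ℝ}
    (hM : ∃ᶠ n in atTop, ((2 : ℝ) ^ (c.b n + 4)) ^ h ≤ c.M n) {A : Set (Fin 1 → ℝ)}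
    (hA : ∀ t, (fun _ => c.point t) ∈ A) : ENNReal.ofReal h ≤ packingDim A := by
  refine le_iInf₂ fun E hE => ?_
  set g : (∀ n, Fin (c.M n)) → Fin 1 → ℝ := fun t _ => c.point t with hg
  have hgc : Continuous g := continuous_pi fun _ => c.continuous_point
  have : Nonempty (∀ n, Fin (c.M n)) := ⟨fun n => ⟨0, c.M_pos n⟩⟩
  obtain ⟨i, t, ht⟩ := nonempty_interior_of_iUnion_of_closed
    (f := fun i => g ⁻¹' closure (E i)) (fun i => isClosed_closure.preimage hgc)
    (eq_univ_of_forall fun t => by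
      obtain ⟨i, hi⟩ := mem_iUnion.1 (hE (hA t))
      exact mem_iUnion.2 ⟨i, subset_closure hi⟩)
  obtain ⟨I, u, hu, hIu⟩ := isOpen_pi_iff.1 isOpen_interior t ht
  obtain ⟨n₀, hn₀⟩ : ∃ n₀, ∀ i ∈ I, i < n₀ :=
    ⟨I.sup id + 1, fun i hi => Nat.lt_succ_of_le (Finset.le_sup (f := id) hi)⟩
  refine le_iSup_of_le i (le_upperBoxDim_of_frequently ?_)
  -- siblings are `2^{-b n} / 2` apart; approximating them by points of `E i` leaves `2^{-b n} / 4`,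
  -- which balls of radius `2^{-b n} / 16` cannot bridge
  have hlim : Tendsto (fun n => (((2 : ℝ≥0) ^ (c.b n + 4))⁻¹)) atTop (𝓝[>] 0) := by
    refine tendsto_nhdsWithin_iff.2 ⟨?_, Eventually.of_forall fun n => ?_⟩
    · refine tendsto_inv_atTop_zero.comp ((tendsto_pow_atTop_atTop_of_one_lt (by norm_num)).comp ?_)
      refine tendsto_atTop_mono (fun n => ?_) tendsto_id
      exact (c.strictMono_a.le_apply.trans (c.a_le n)).trans (Nat.le_add_right _ _)
    · exact mem_Ioi.2 (by positivity)
  refine hlim.frequently ((hM.and_eventually (eventually_ge_atTop n₀)).mono ?_)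
  rintro n ⟨hMn, hn⟩
  set δ : ℝ := (2 ^ c.b n)⁻¹ with hδ
  have hδ0 : 0 < δ := by positivity
  have hmem : ∀ j : Fin (c.M n), g (Function.update t n j) ∈ closure (E i) := fun j => by
    have : Function.update t n j ∈ g ⁻¹' closure (E i) := by
      refine interior_subset (hIu fun m hm => ?_)
      rw [Function.update_of_ne (by have := hn₀ m hm; omega)]
      exact (hu m hm).2
    exact this
  have hex : ∀ j : Fin (c.M n), ∃ z ∈ E i, dist (g (Function.update t n j)) z < δ / 8 :=
    fun j => Metric.mem_closure_iff.1 (hmem j) _ (by positivity)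
  choose z hzE hz using hex
  have hsep : ∀ j j', j ≠ j' → δ / 4 ≤ dist (z j) (z j') := fun j j' hjj => by
    have h1 : δ / 2 ≤ dist (g (Function.update t n j)) (g (Function.update t n j')) := by
      have h2 := c.le_abs_point_sub (t := Function.update t n j) (t' := Function.update t n j')
        (n := n) (fun m hm => by
          rw [Function.update_of_ne hm.ne, Function.update_of_ne hm.ne]) (by simpa using hjj)
      refine h2.trans ?_
      rw [← Real.dist_eq]
      exact dist_le_pi_dist (g (Function.update t n j)) (g (Function.update t n j')) 0
    have h4 := hz j
    have h5 := hz j'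
    have h6 := dist_triangle (g (Function.update t n j)) (z j) (g (Function.update t n j'))
    have h7 := dist_triangle (z j) (z j') (g (Function.update t n j'))
    rw [dist_comm (z j') _] at h7
    linarith
  have hinj : Function.Injective z := fun j j' e => by
    by_contra hne
    have := hsep j j' hne
    rw [e, dist_self] at this
    linarith
  have hpack : Metric.IsSeparated ((2 * ((2 : ℝ≥0) ^ (c.b n + 4))⁻¹ : ℝ≥0) : ℝ≥0∞)
      (Set.range z) := by
    rintro _ ⟨j, rfl⟩ _ ⟨j', rfl⟩ hne
    have := hsep j j' fun e => hne (by rw [e])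
    rw [edist_dist, ← ENNReal.ofReal_coe_nnreal]
    rw [ENNReal.ofReal_lt_ofReal_iff_of_nonneg (by positivity)]
    refine lt_of_lt_of_le ?_ this
    push_cast
    rw [pow_add, mul_inv, ← hδ]
    linarith
  have hcard := (hpack.encard_le_packingNumber (range_subset_iff.2 hzE)).trans
    (Metric.packingNumber_two_mul_le_externalCoveringNumber _ _)
  rw [← Set.image_univ, hinj.encard_image, Set.encard_univ] at hcard
  have hcard' : ((c.M n : ℕ∞) : ℝ≥0∞) ≤
      (Metric.externalCoveringNumber ((2 : ℝ≥0) ^ (c.b n + 4))⁻¹ (E i) : ℕ∞) := by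
    refine ENat.toENNReal_le.2 (le_trans ?_ hcard)
    simp
  refine le_trans ?_ hcard'
  rw [ENat.toENNReal_coe, ← ENNReal.ofReal_natCast]
  apply ENNReal.ofReal_le_ofReal
  refine le_of_eq_of_le ?_ hMn
  push_cast
  rw [Real.rpow_neg (by positivity), Real.inv_rpow (by positivity), inv_inv]

end CantorData

/-! ### Growth and decay of lacunary series -/

theorem le_liminf_log_div {E : Type*} [SeminormedAddCommGroup E] {u : ℕ → E} {β m : ℝ} (hm : 0 < m)
    (h : ∀ᶠ j : ℕ in atTop, m * 2 ^ (β * j) ≤ ‖u j‖) :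
    (β : EReal) ≤ liminf (fun j : ℕ =>
      ENNReal.log ‖u j‖ₑ / (((j : ℝ) * Real.log 2 : ℝ) : EReal)) atTop := by
  rw [← EReal.ge_of_forall_gt_iff_ge]
  intro β' hβ'
  have hβ : β' < β := by exact_mod_cast hβ'
  refine le_liminf_of_le (by isBoundedDefault) ?_
  have hlim : Tendsto (fun j : ℕ => (2 : ℝ) ^ ((β - β') * j)) atTop atTop := by
    have h2 : (1 : ℝ) < 2 ^ (β - β') := Real.one_lt_rpow (by norm_num) (by linarith)
    refine (tendsto_pow_atTop_atTop_of_one_lt h2).congr fun j => ?_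
    rw [Real.rpow_mul (by norm_num), Real.rpow_natCast]
  filter_upwards [h, hlim.eventually_ge_atTop m⁻¹, eventually_gt_atTop 0] with j hj hj' hj0
  have hpos : 0 < (j : ℝ) * Real.log 2 := by positivity
  rw [EReal.le_div_iff_mul_le (by exact_mod_cast hpos) (EReal.coe_ne_top _)]
  have h2 : ((β' : ℝ) : EReal) * (((j : ℝ) * Real.log 2 : ℝ) : EReal) =
      ENNReal.log (ENNReal.ofReal (2 ^ (β' * j))) := by
    rw [ENNReal.log_ofReal_of_pos (by positivity), Real.log_rpow (by norm_num), ← EReal.coe_mul,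
      mul_assoc]
  rw [h2, ENNReal.log_le_log_iff, ← ofReal_norm]
  apply ENNReal.ofReal_le_ofReal
  refine le_trans ?_ hj
  have e : (2 : ℝ) ^ (β * j) = 2 ^ ((β - β') * j) * 2 ^ (β' * j) := by
    rw [← Real.rpow_add (by norm_num)]; ring_nf
  rw [e, ← mul_assoc]
  refine le_mul_of_one_le_left (by positivity) ?_
  rwa [← div_le_iff₀' hm, one_div]

/-- Reindexing a block of a lacunary sum. -/
theorem sum_Ico_eq_of_lacunary {E : Type*} [AddCommMonoid E] {a : ℕ → ℕ} (ha : StrictMono a)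
    {q : ℕ → E} (hq : ∀ l, l ∉ Set.range a → q l = 0) {j N n n' : ℕ}
    (hj : ∀ i, j ≤ a i ↔ n ≤ i) (hN : ∀ i, a i < N ↔ i < n') :
    ∑ l ∈ Finset.Ico j N, q l = ∑ i ∈ Finset.Ico n n', q (a i) := by
  refine Eq.trans ?_ (Finset.sum_map (Finset.Ico n n') ⟨a, ha.injective⟩ q)
  symm
  refine Finset.sum_subset (fun l hl => ?_) fun l hl hl' => hq l ?_
  · obtain ⟨i, hi, rfl⟩ := Finset.mem_map.1 hl
    rw [Finset.mem_Ico] at hi ⊢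
    exact ⟨(hj i).2 hi.1, (hN i).2 hi.2⟩
  · rintro ⟨i, rfl⟩
    rw [Finset.mem_Ico] at hl
    exact hl' (Finset.mem_map.2 ⟨i, Finset.mem_Ico.2 ⟨(hj i).1 hl.1, (hN i).1 hl.2⟩, rfl⟩)

/-- In a sum of rapidly increasing terms, the last one dominates. -/
theorem le_norm_sum_of_increasing {E : Type*} [SeminormedAddCommGroup E] {A : ℕ → ℝ} {κ m K : ℝ}
    (hA : ∀ n, 0 ≤ A n) (hκ : 0 ≤ κ) (hκ' : κ ≤ 1 / 2) (hstep : ∀ n, A n ≤ κ * A (n + 1))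
    (hK : 0 ≤ K) (hm : K * (2 * κ) ≤ m / 2) {v : ℕ → E} (hv : ∀ n, m * A n ≤ ‖v n‖)
    (hv' : ∀ n, ‖v n‖ ≤ K * A n) (n : ℕ) :
    m / 2 * A n ≤ ‖∑ i ∈ Finset.range (n + 1), v i‖ := by
  have hsum : ∀ n, ∑ i ∈ Finset.range n, A i ≤ 2 * κ * A n := fun n => by
    induction n with
    | zero => simpa using mul_nonneg (mul_nonneg zero_le_two hκ) (hA 0)
    | succ n ih =>
      rw [Finset.sum_range_succ]
      nlinarith [hstep n, hA n, hA (n + 1)]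
  rw [Finset.sum_range_succ, add_comm]
  have h1 : ‖∑ i ∈ Finset.range n, v i‖ ≤ K * (2 * κ) * A n := by
    calc _ ≤ ∑ i ∈ Finset.range n, K * A i := norm_sum_le_of_le _ fun i _ => hv' i
      _ = K * ∑ i ∈ Finset.range n, A i := by rw [Finset.mul_sum]
      _ ≤ K * (2 * κ * A n) := mul_le_mul_of_nonneg_left (hsum n) hK
      _ = _ := by ring
  have h2 := norm_sub_le_norm_add (v n) (∑ i ∈ Finset.range n, v i)
  have h3 := mul_le_mul_of_nonneg_right hm (hA n)
  linarith [hv n]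

theorem sum_Ico_succ_le_of_decreasing {A : ℕ → ℝ} {κ : ℝ} (hA : ∀ n, 0 ≤ A n)
    (hκ' : κ ≤ 1 / 2) (hstep : ∀ n, A (n + 1) ≤ κ * A n) {n N : ℕ} (hN : n ≤ N) :
    ∑ i ∈ Finset.Ico n N, A (i + 1) ≤ 2 * κ * (A n - A N) := by
  induction N, hN using Nat.le_induction with
  | base => simp
  | succ N hN ih =>
    rw [Finset.sum_Ico_succ_top hN]
    nlinarith [hstep N, hA N, hA (N + 1)]

/-- In a sum of rapidly decreasing terms, the first one dominates. -/
theorem le_norm_sum_of_decreasing {E : Type*} [SeminormedAddCommGroup E] {A : ℕ → ℝ} {κ m K : ℝ}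
    (hA : ∀ n, 0 ≤ A n) (hκ : 0 ≤ κ) (hκ' : κ ≤ 1 / 2) (hstep : ∀ n, A (n + 1) ≤ κ * A n)
    (hK : 0 ≤ K) (hm : K * (2 * κ) ≤ m / 2) {v : ℕ → E} (hv : ∀ n, m * A n ≤ ‖v n‖)
    (hv' : ∀ n, ‖v n‖ ≤ K * A n) {n N : ℕ} (hN : n ≤ N) :
    m / 2 * A n ≤ ‖∑ i ∈ Finset.Ico n (N + 1), v i‖ := by
  rw [Finset.sum_eq_sum_Ico_succ_bot (by omega), ← Finset.sum_Ico_add' v n N 1]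
  have h1 : ‖∑ i ∈ Finset.Ico n N, v (i + 1)‖ ≤ K * (2 * κ) * A n := by
    calc _ ≤ ∑ i ∈ Finset.Ico n N, K * A (i + 1) := norm_sum_le_of_le _ fun i _ => hv' _
      _ = K * ∑ i ∈ Finset.Ico n N, A (i + 1) := by rw [Finset.mul_sum]
      _ ≤ K * (2 * κ * (A n - A N)) :=
        mul_le_mul_of_nonneg_left (sum_Ico_succ_le_of_decreasing hA hκ' hstep hN) hK
      _ ≤ K * (2 * κ * A n) := by
        have := hA N
        gcongr
        linarith
      _ = _ := by ring
  have h2 := norm_sub_le_norm_add (v n) (∑ i ∈ Finset.Ico n N, v (i + 1))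
  have h3 := mul_le_mul_of_nonneg_right hm (hA n)
  linarith [hv n]

theorem exists_generation {a : ℕ → ℕ} (ha : StrictMono a) {j : ℕ} (hj : a 0 < j) :
    ∃ n, a n < j ∧ j ≤ a (n + 1) := by
  have hex : ∃ n, j ≤ a n := ⟨j, ha.le_apply⟩
  obtain ⟨n, hn⟩ : ∃ n, Nat.find hex = n + 1 := by
    refine Nat.exists_eq_succ_of_ne_zero fun h => ?_
    have := Nat.find_spec hex
    rw [h] at this
    omega
  refine ⟨n, not_le.1 (Nat.find_min hex (by omega)), ?_⟩
  have := Nat.find_spec hex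
  rwa [hn] at this

namespace WaveletSystem

variable {𝕜 : Type*} [RCLike 𝕜] {d : ℕ}

/-- Lower bound for partial reconstructions of a lacunary series with growing coefficients. -/
theorem mem_levelSetPlus_of_pos (W : WaveletSystem 𝕜 d) {f : (Fin d → ℝ) → 𝕜} {x : Fin d → ℝ}
    {β : ℝ} (hβ : 0 < β) (hsc : ∀ k, W.scalingCoeff f k = 0) {a : ℕ → ℕ} (ha : StrictMono a)
    (h0 : ∀ j, j ∉ Set.range a → W.detail f j x = 0) {A : ℕ → ℝ} {κ m K : ℝ}
    (hA : ∀ n, A n = 2 ^ (β * a (n + 1))) (hκ : 0 ≤ κ) (hκ' : κ ≤ 1 / 2)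
    (hstep : ∀ n, A n ≤ κ * A (n + 1)) (hm0 : 0 < m) (hK : 0 ≤ K) (hm : K * (2 * κ) ≤ m / 2)
    (hv : ∀ n, m * A n ≤ ‖W.detail f (a n) x‖) (hv' : ∀ n, ‖W.detail f (a n) x‖ ≤ K * A n) :
    x ∈ W.levelSetPlus β f := by
  refine Or.inl ⟨hβ, le_liminf_log_div (half_pos hm0) ?_⟩
  filter_upwards [eventually_gt_atTop (a 0)] with j hj
  obtain ⟨n, hn, hn'⟩ := exists_generation ha hj
  have hrec : W.reconstruction f j x = ∑ i ∈ Finset.range (n + 1), W.detail f (a i) x := by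
    simp only [reconstruction, hsc, zero_mul, tsum_zero, zero_add]
    rw [Finset.range_eq_Ico, Finset.range_eq_Ico]
    refine sum_Ico_eq_of_lacunary ha h0 (by simp) fun i => ⟨fun h => ?_, fun h => ?_⟩
    · exact ha.lt_iff_lt.1 (h.trans_le hn')
    · exact (ha.monotone (Nat.le_of_lt_succ h)).trans_lt hn
  rw [hrec]
  refine le_trans ?_ (le_norm_sum_of_increasing (fun n => by rw [hA]; positivity) hκ hκ' hstep hK hm
    hv hv' n)
  rw [hA]
  gcongr
  norm_num

/-- Lower bound for the remainders of a lacunary series with decaying coefficients. -/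
theorem mem_levelSetPlus_of_neg (W : WaveletSystem 𝕜 d) {f : (Fin d → ℝ) → 𝕜} {x : Fin d → ℝ}
    {β : ℝ} (hβ : β < 0) {a : ℕ → ℕ} (ha : StrictMono a)
    (h0 : ∀ j, j ∉ Set.range a → W.detail f j x = 0) {A : ℕ → ℝ} {κ m K : ℝ}
    (hA0 : ∀ n, 0 ≤ A n) (hA : ∀ n, A (n + 1) = 2 ^ (β * a n)) (hκ : 0 ≤ κ) (hκ' : κ ≤ 1 / 2)
    (hstep : ∀ n, A (n + 1) ≤ κ * A n) (hm0 : 0 < m) (hK : 0 ≤ K) (hm : K * (2 * κ) ≤ m / 2)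
    (hv : ∀ n, m * A n ≤ ‖W.detail f (a n) x‖) (hv' : ∀ n, ‖W.detail f (a n) x‖ ≤ K * A n) :
    x ∈ W.levelSetPlus β f := by
  have hAsum : Summable A := by
    rw [← summable_nat_add_iff 1]
    refine summable_of_sum_range_le (c := 2 * κ * A 0) (fun n => hA0 _) fun N => ?_
    rw [Finset.range_eq_Ico]
    refine (sum_Ico_succ_le_of_decreasing hA0 hκ' hstep (Nat.zero_le N)).trans ?_
    have := hA0 N
    gcongr
    linarith
  have hsum : Summable fun l => W.detail f l x := by
    rw [← ha.injective.summable_iff fun j hj => h0 j hj]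
    exact Summable.of_norm_bounded (hAsum.mul_left K) hv'
  have hconv : W.ConvergesAt f x := ⟨_, hsum.hasSum.tendsto_sum_nat.const_add _⟩
  refine Or.inr ⟨hβ, hconv, le_liminf_log_div (half_pos hm0) ?_⟩
  filter_upwards [eventually_gt_atTop (a 0)] with j hj
  obtain ⟨n, hn, hn'⟩ := exists_generation ha hj
  have htend := (hconv.tendsto_remainder j).comp
    (ha.tendsto_atTop.comp (tendsto_add_atTop_nat 1))
  refine ge_of_tendsto htend.norm ?_
  filter_upwards [eventually_ge_atTop (n + 1)] with N hN
  have hsumN : ∑ l ∈ Finset.Ico j (a (N + 1)), W.detail f l x =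
      ∑ i ∈ Finset.Ico (n + 1) (N + 1), W.detail f (a i) x := by
    refine sum_Ico_eq_of_lacunary ha h0 (fun i => ⟨fun h => ?_, fun h => ?_⟩) fun i => ha.lt_iff_lt
    · exact ha.lt_iff_lt.1 (hn.trans_le h)
    · exact hn'.trans (ha.monotone h)
  simp only [Function.comp]
  rw [hsumN]
  refine le_trans ?_ (le_norm_sum_of_decreasing hA0 hκ hκ' hstep hK hm hv hv' hN)
  rw [hA]
  refine mul_le_mul_of_nonneg_left ?_ (half_pos hm0).le
  apply Real.rpow_le_rpow_of_exponent_le (by norm_num)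
  have : (a n : ℝ) ≤ j := by exact_mod_cast hn.le
  nlinarith

end WaveletSystem

/-! ### Choice of the levels and branching numbers -/

/-- The exponents of the construction. Generations follow each other either closely or by a jump
from level `a` to level `L a`, during which the intervals branch freely down to the scale
`2^{-w a}`; a jump happens when there are at most `2^{ε a}` intervals. The number of intervals stays
below `2^{κ a}`. The parameters are `σ = 1 - sp`, `B = max (β p) 0` and `H = 1 - sp - β p`. -/
structure JumpExponents (σ B H : ℝ) where
  /-- the relative level down to which the intervals branch freely -/
  w : ℝ
  /-- the relative length of a jump -/
  L : ℝ
  /-- the exponent of the number of intervals before a jump -/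
  ε : ℝ
  /-- the exponential rate of decay of the Besov norms of the levels -/
  η : ℝ
  /-- the exponent bounding the number of intervals -/
  κ : ℝ
  /-- a lower bound for the dimension -/
  h : ℝ
  one_le_w : 1 ≤ w
  w_le_L : w ≤ L
  ε_pos : 0 < ε
  η_pos : 0 < η
  κ_pos : 0 < κ
  κ_le : κ ≤ 1
  branch_le : ε + w - 1 ≤ κ * L
  jump_le : B * L + ε + η ≤ σ
  step_le : κ ≤ σ - B - η
  lt_h : H < h
  h_nonneg : 0 ≤ h
  h_lt : h * w < w - 1

/-- For `β < 0` the amplitude before a jump does not depend on its length, so jumps may be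
arbitrarily long. -/
theorem exists_jumpExponents_zero {σ H : ℝ} (hσ : 0 < σ) (hσ' : σ < 1) (hH : 0 < H) (hH' : H < 1) :
    Nonempty (JumpExponents σ 0 H) := by
  have h1 : 0 < 1 - H := by linarith
  refine ⟨⟨3 / (1 - H), 3 / (1 - H) + (3 / (1 - H)) / (σ / 2), σ / 2, σ / 2, σ / 2, (1 + H) / 2,
    ?_, ?_, by linarith, by linarith, by linarith, by linarith, ?_, by linarith, by linarith,
    by linarith, by linarith, ?_⟩⟩
  · rw [le_div_iff₀ h1]; linarith
  · have : 0 < 3 / (1 - H) / (σ / 2) := by positivity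
    linarith
  · have : 0 < 3 / (1 - H) := by positivity
    rw [mul_add, mul_div_cancel₀ _ (by positivity)]
    nlinarith
  · have : 3 / (1 - H) * (1 - H) = 3 := div_mul_cancel₀ _ h1.ne'
    nlinarith

/-- For `β > 0` the amplitude before a jump of relative length `L` is `2^{β L a}`, which the Besov
norm tolerates only for `L < σ / B`; such jumps are long enough. -/
theorem exists_jumpExponents_pos {σ B : ℝ} (hσ' : σ < 1) (hB : 0 < B) (hBσ : B < σ) :
    Nonempty (JumpExponents σ B (σ - B)) := by
  set H := σ - B with hH
  have hH0 : 0 < H := by linarith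
  have h1 : 0 < 1 - H := by linarith
  -- a jump of relative length `L < σ / B` is affordable, and `L > 1 / (1 - H)` makes it useful
  obtain ⟨L, hL1, hL2⟩ : ∃ L, 1 / (1 - H) < L ∧ L < σ / B := by
    apply exists_between
    rw [div_lt_div_iff₀ h1 hB]
    nlinarith
  rw [div_lt_iff₀ h1] at hL1
  rw [lt_div_iff₀ hB] at hL2
  obtain ⟨w, hw1, hw2⟩ : ∃ w, 1 / (1 - H) < w ∧ w < 1 + H * L := by
    apply exists_between
    rw [div_lt_iff₀ h1]
    nlinarith
  rw [div_lt_iff₀ h1] at hw1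
  have hL0 : 0 < L := by nlinarith
  have hw0 : 0 < w := by nlinarith
  obtain ⟨h, hh1, hh2⟩ : ∃ h, H < h ∧ h < (w - 1) / w := by
    apply exists_between
    rw [lt_div_iff₀ hw0]
    linarith
  rw [lt_div_iff₀ hw0] at hh2
  set ε := min ((1 + H * L - w) / 2) ((σ - B * L) / 2) with hε
  set η := min ((σ - B * L) / 2) (min ((1 + H * L - w) / (2 * L)) (H / 2)) with hη
  have e1 : ε ≤ (1 + H * L - w) / 2 := min_le_left _ _
  have e2 : ε ≤ (σ - B * L) / 2 := min_le_right _ _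
  have e3 : η ≤ (σ - B * L) / 2 := min_le_left _ _
  have e4 : η ≤ (1 + H * L - w) / (2 * L) := (min_le_right _ _).trans (min_le_left _ _)
  have e5 : η ≤ H / 2 := (min_le_right _ _).trans (min_le_right _ _)
  have e6 : η * L ≤ (1 + H * L - w) / 2 := by
    rw [le_div_iff₀ (by positivity)] at e4
    linarith
  refine ⟨⟨w, L, ε, η, H - η, h, ?_, ?_, ?_, ?_, by linarith, ?_, ?_, by linarith, by linarith,
    hh1, by linarith, hh2⟩⟩
  · nlinarith
  · nlinarith
  · exact lt_min (by linarith) (by linarith)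
  · exact lt_min (by linarith) (lt_min (div_pos (by linarith) (by positivity)) (by linarith))
  · have : 0 < η := lt_min (by linarith)
      (lt_min (div_pos (by linarith) (by positivity)) (by linarith))
    linarith
  · linarith

namespace JumpExponents

variable {σ B H : ℝ} (e : JumpExponents σ B H) (r D : ℕ)

open Classical in
/-- The number of children of each interval, when there are `q.2` intervals of level `q.1`. -/
def mult (q : ℕ × ℕ) : ℕ := if (q.2 : ℝ) ≤ 2 ^ (e.ε * q.1) then 2 ^ (⌊e.w * q.1⌋₊ - q.1) else 1

open Classical in
/-- The level of the gaps between siblings, up to an additive constant. -/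
def gap (q : ℕ × ℕ) : ℕ := if (q.2 : ℝ) ≤ 2 ^ (e.ε * q.1) then ⌊e.w * q.1⌋₊ else q.1

open Classical in
/-- The next level, up to an additive constant. -/
def next (q : ℕ × ℕ) : ℕ := if (q.2 : ℝ) ≤ 2 ^ (e.ε * q.1) then ⌊e.L * q.1⌋₊ else q.1

/-- Level and number of intervals of the generations. -/
def state (a₀ : ℕ) : ℕ → ℕ × ℕ
  | 0 => (a₀, 1)
  | n + 1 => (e.next (state a₀ n) + r + D, (state a₀ n).2 * e.mult (state a₀ n))

theorem le_gap (q : ℕ × ℕ) : q.1 ≤ e.gap q := by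
  unfold gap
  split_ifs
  · apply Nat.le_floor
    exact le_mul_of_one_le_left (Nat.cast_nonneg _) e.one_le_w
  · exact le_rfl

theorem gap_le_next (q : ℕ × ℕ) : e.gap q ≤ e.next q := by
  unfold gap next
  split_ifs
  · exact Nat.floor_mono (mul_le_mul_of_nonneg_right e.w_le_L (Nat.cast_nonneg _))
  · exact le_rfl

theorem mult_pos (q : ℕ × ℕ) : 0 < e.mult q := by
  unfold mult
  split_ifs <;> positivity

theorem mult_mul_le (q : ℕ × ℕ) : (e.mult q : ℝ) * 2 ^ q.1 ≤ 2 ^ e.gap q := by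
  have h := e.le_gap q
  unfold gap at h
  unfold mult gap
  split_ifs with hJ
  · rw [if_pos hJ] at h
    push_cast
    rw [← pow_add, Nat.sub_add_cancel h]
  · simp

/-- The Cantor set with the given exponents and reference interval `[y, y + ρ]`. -/
def data (a₀ : ℕ) {y ρ : ℝ} (hρ : 0 < ρ) (hρ1 : ρ ≤ 1) (hD : 2 ≤ D) (hDρ : 4 ≤ (2 : ℝ) ^ D * ρ)
    (hr : 1 ≤ (2 : ℝ) ^ r * (ρ / 2)) : CantorData where
  a n := (e.state r D a₀ n).1
  b n := e.gap (e.state r D a₀ n) + r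
  M n := e.mult (e.state r D a₀ n)
  y := y
  ρ := ρ
  D := D
  ρ_pos := hρ
  ρ_le := hρ1
  two_le_D := hD
  D_le := hDρ
  M_pos n := e.mult_pos _
  b_add_le n := Nat.add_le_add_right (Nat.add_le_add_right (e.gap_le_next _) _) _
  a_le n := (e.le_gap _).trans (Nat.le_add_right _ _)
  M_le n := by
    refine (e.mult_mul_le _).trans ?_
    rw [pow_add, mul_assoc]
    exact le_mul_of_one_le_right (by positivity) hr

theorem prod_mult (a₀ n : ℕ) :
    ∏ i ∈ Finset.range n, e.mult (e.state r D a₀ i) = (e.state r D a₀ n).2 := by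
  induction n with
  | zero => rfl
  | succ n ih => rw [Finset.prod_range_succ, ih]; rfl

theorem state_snd_le (a₀ : ℕ) (hD : 2 ≤ D) (n : ℕ) :
    ((e.state r D a₀ n).2 : ℝ) ≤ 2 ^ (e.κ * (e.state r D a₀ n).1) := by
  have hκ := e.κ_pos
  induction n with
  | zero =>
    simp only [state, Nat.cast_one]
    exact Real.one_le_rpow (by norm_num) (by positivity)
  | succ n ih =>
    set q := e.state r D a₀ n with hq
    change ((q.2 * e.mult q : ℕ) : ℝ) ≤ 2 ^ (e.κ * ((e.next q + r + D : ℕ) : ℝ))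
    by_cases hJ : (q.2 : ℝ) ≤ 2 ^ (e.ε * q.1)
    · have hg := e.le_gap q
      rw [gap, if_pos hJ] at hg
      rw [mult, if_pos hJ, next, if_pos hJ]
      push_cast
      calc (q.2 : ℝ) * 2 ^ (⌊e.w * q.1⌋₊ - q.1)
          ≤ 2 ^ (e.ε * q.1) * 2 ^ (e.w * q.1 - q.1) := by
            refine mul_le_mul hJ ?_ (by positivity) (by positivity)
            rw [← Real.rpow_natCast, Nat.cast_sub hg]
            apply Real.rpow_le_rpow_of_exponent_le (by norm_num)
            have := Nat.floor_le (a := e.w * q.1) (by have := e.one_le_w; positivity)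
            linarith
        _ = 2 ^ ((e.ε + e.w - 1) * q.1) := by
            rw [← Real.rpow_add (by norm_num)]; ring_nf
        _ ≤ _ := by
            apply Real.rpow_le_rpow_of_exponent_le (by norm_num)
            have h1 := (Nat.lt_floor_add_one (e.L * q.1)).le
            have h2 : (2 : ℝ) ≤ D := by exact_mod_cast hD
            have h3 : e.L * q.1 ≤ ⌊e.L * q.1⌋₊ + r + D := by
              linarith [(Nat.cast_nonneg r : (0 : ℝ) ≤ r)]
            calc (e.ε + e.w - 1) * q.1 ≤ e.κ * e.L * q.1 :=
                  mul_le_mul_of_nonneg_right e.branch_le (Nat.cast_nonneg _)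
              _ = e.κ * (e.L * q.1) := by ring
              _ ≤ _ := mul_le_mul_of_nonneg_left h3 hκ.le
    · rw [mult, if_neg hJ, next, if_neg hJ, mul_one]
      refine ih.trans ?_
      apply Real.rpow_le_rpow_of_exponent_le (by norm_num)
      refine mul_le_mul_of_nonneg_left ?_ hκ.le
      push_cast
      linarith [(Nat.cast_nonneg r : (0 : ℝ) ≤ r), (Nat.cast_nonneg D : (0 : ℝ) ≤ D)]

/-- With amplitudes at most `2^{B a (n+1) / p}`, the `p`-th power of the `ℓᵖ` norm of generation `n`
is smaller than `2^{σ a n}` by an exponential factor. -/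
theorem budget_le (hB : 0 ≤ B) (a₀ : ℕ) (hD : 2 ≤ D) (n : ℕ) :
    ((e.state r D a₀ n).2 : ℝ) * 2 ^ (B * (e.state r D a₀ (n + 1)).1) ≤
      2 ^ (B * (r + D)) * 2 ^ ((σ - e.η) * (e.state r D a₀ n).1) := by
  have ih := e.state_snd_le r D a₀ hD n
  set q := e.state r D a₀ n with hq
  change (q.2 : ℝ) * 2 ^ (B * ((e.next q + r + D : ℕ) : ℝ)) ≤ _
  have hq0 : (0 : ℝ) ≤ q.1 := Nat.cast_nonneg _
  have hL0 : 0 ≤ e.L := by linarith [e.one_le_w, e.w_le_L]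
  by_cases hJ : (q.2 : ℝ) ≤ 2 ^ (e.ε * q.1)
  · rw [next, if_pos hJ]
    refine (mul_le_mul_of_nonneg_right hJ (by positivity)).trans ?_
    rw [← Real.rpow_add (by norm_num), ← Real.rpow_add (by norm_num)]
    apply Real.rpow_le_rpow_of_exponent_le (by norm_num)
    have h1 := mul_le_mul_of_nonneg_left (Nat.floor_le (a := e.L * q.1) (by positivity)) hB
    have h2 := mul_le_mul_of_nonneg_right e.jump_le hq0
    push_cast
    linarith
  · rw [next, if_neg hJ]
    refine (mul_le_mul_of_nonneg_right ih (by positivity)).trans ?_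
    rw [← Real.rpow_add (by norm_num), ← Real.rpow_add (by norm_num)]
    apply Real.rpow_le_rpow_of_exponent_le (by norm_num)
    have h2 := mul_le_mul_of_nonneg_right e.step_le hq0
    push_cast
    linarith

theorem le_state (a₀ : ℕ) (hD : 2 ≤ D) (n : ℕ) : n ≤ (e.state r D a₀ n).1 := by
  induction n with
  | zero => exact Nat.zero_le _
  | succ n ih =>
    have h1 := (e.le_gap (e.state r D a₀ n)).trans (e.gap_le_next _)
    change n + 1 ≤ e.next (e.state r D a₀ n) + r + D
    omega

/-- Jumps happen infinitely often, since between jumps the number of intervals is constant. -/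
theorem frequently_jump (a₀ : ℕ) (hD : 2 ≤ D) :
    ∃ᶠ n in atTop, ((e.state r D a₀ n).2 : ℝ) ≤ 2 ^ (e.ε * (e.state r D a₀ n).1) := by
  intro hev
  obtain ⟨n₀, hn₀⟩ := eventually_atTop.1 hev
  have hconst : ∀ n ≥ n₀, (e.state r D a₀ n).2 = (e.state r D a₀ n₀).2 := fun n hn => by
    induction n, hn using Nat.le_induction with
    | base => rfl
    | succ n hn ih =>
      change (e.state r D a₀ n).2 * e.mult (e.state r D a₀ n) = _
      rw [mult, if_neg (hn₀ n hn), mul_one, ih]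
  have h2 : (1 : ℝ) < 2 ^ e.ε := Real.one_lt_rpow (by norm_num) e.ε_pos
  obtain ⟨n, hn, hn'⟩ := (((tendsto_pow_atTop_atTop_of_one_lt h2).eventually_ge_atTop
    ((e.state r D a₀ n₀).2 : ℝ)).and (eventually_ge_atTop n₀)).exists
  refine hn₀ n hn' ?_
  beta_reduce
  rw [hconst n hn']
  refine hn.trans ?_
  rw [← Real.rpow_natCast, ← Real.rpow_mul (by norm_num)]
  apply Real.rpow_le_rpow_of_exponent_le (by norm_num)
  refine mul_le_mul_of_nonneg_left ?_ e.ε_pos.le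
  exact_mod_cast e.le_state r D a₀ hD n

/-- At the jumps, the number of siblings beats the dimension `h`. -/
theorem frequently_mult (a₀ : ℕ) (hD : 2 ≤ D) :
    ∃ᶠ n in atTop, ((2 : ℝ) ^ (e.gap (e.state r D a₀ n) + r + 4)) ^ e.h ≤
      (e.mult (e.state r D a₀ n) : ℝ) := by
  have hpos : 0 < e.w - 1 - e.h * e.w := by linarith [e.h_lt]
  obtain ⟨n₁, hn₁⟩ := exists_nat_ge ((e.h * (r + 4) + 1) / (e.w - 1 - e.h * e.w))
  refine ((e.frequently_jump r D a₀ hD).and_eventually (eventually_ge_atTop n₁)).mono ?_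
  rintro n ⟨hJ, hn⟩
  have hqn := e.le_state r D a₀ hD n
  set q := e.state r D a₀ n with hq
  have hg := e.le_gap q
  rw [gap, if_pos hJ] at hg
  rw [mult, if_pos hJ, gap, if_pos hJ]
  push_cast
  rw [← Real.rpow_natCast, ← Real.rpow_natCast, ← Real.rpow_mul (by norm_num)]
  apply Real.rpow_le_rpow_of_exponent_le (by norm_num)
  rw [Nat.cast_sub hg]
  push_cast
  have h1 := Nat.floor_le (a := e.w * q.1) (by have := e.one_le_w; positivity)
  have h2 := Nat.lt_floor_add_one (e.w * q.1)
  have h3 : (n₁ : ℝ) ≤ q.1 := by exact_mod_cast hn.trans hqn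
  have h4 := hn₁.trans h3
  rw [div_le_iff₀ hpos] at h4
  have h5 := mul_le_mul_of_nonneg_left h1 e.h_nonneg
  nlinarith

end JumpExponents

/-! ### The lower bound for the packing dimension -/

namespace WaveletSystem

variable {𝕜 : Type*} [RCLike 𝕜]

theorem exists_wavelet_ne_zero {d : ℕ} (W : WaveletSystem 𝕜 d) (i : Fin (2 ^ d - 1)) :
    ∃ z, W.ψ i z ≠ 0 := by
  by_contra! h
  classical
  have := W.waveletCoeff_dyadicAtom i i 0 0 0 0
  rw [if_pos rfl] at this
  simp [waveletCoeff, dyadicAtom, h] at this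

/-- At a point of the Cantor set, exactly one atom of each generation is nonzero. -/
theorem atomSum_point (W : WaveletSystem 𝕜 1) (i : Fin (2 ^ 1 - 1)) {R : ℝ}
    (hR : ∀ y, R < ‖y‖ → W.ψ i y = 0) (c : CantorData) (hc : |c.y| + 1 + R < 2 ^ c.D)
    (n : ℕ) (A : ℝ) (t : ∀ n, Fin (c.M n)) :
    W.atomSum i (c.a n) A ((c.nodes n).image fun k _ => k) (fun _ => c.point t) =
      (A : 𝕜) * W.ψ i (fun _ => 2 ^ c.a n * c.point t - c.index t n) := by
  unfold atomSum
  rw [Finset.sum_eq_single (fun _ => c.index t n)]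
  · simp [dyadicAtom]
  · intro k hk hne
    obtain ⟨k, hkn, rfl⟩ := Finset.mem_image.1 hk
    have hne' : k ≠ c.index t n := fun e => hne (by rw [e])
    have hsep : (2 : ℝ) ^ c.D ≤ |(k : ℝ) - c.index t n| := by
      exact_mod_cast c.nodes_separated n k hkn _ (c.index_mem t n) hne'
    refine hR _ ?_
    have h1 := c.scaled_point_mem t n
    have h2 := norm_le_pi_norm
      (fun _ : Fin 1 => (2 : ℝ) ^ ((c.a n : ℕ) : ℤ) * c.point t - (k : ℝ)) 0
    refine lt_of_lt_of_le ?_ h2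
    rw [Real.norm_eq_abs, zpow_natCast]
    have h3 : |(2 : ℝ) ^ c.a n * c.point t - c.index t n| ≤ |c.y| + 1 := by
      rw [abs_le]
      have := c.ρ_le
      constructor
      · linarith [h1.1, neg_abs_le c.y, abs_nonneg c.y]
      · linarith [h1.2, le_abs_self c.y]
    have h4 := abs_sub_abs_le_abs_sub ((k : ℝ) - c.index t n)
      ((2 : ℝ) ^ c.a n * c.point t - c.index t n)
    have e : (k : ℝ) - c.index t n - ((2 : ℝ) ^ c.a n * c.point t - c.index t n) =
        -((2 : ℝ) ^ c.a n * c.point t - k) := by ring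
    rw [e, abs_neg] at h4
    linarith
  · intro h
    exact absurd (Finset.mem_image.2 ⟨_, c.index_mem t n, rfl⟩) h

/-- The lacunary wavelet series carried by a Cantor set, with amplitude `A n` on generation `n`. -/
theorem exists_memBesov_cantor (W : WaveletSystem 𝕜 1) {p s : ℝ} (hp : 1 ≤ p) (hs : 0 ≤ s)
    {i : Fin (2 ^ 1 - 1)} (hψ : Continuous (W.ψ i)) (hsupp : HasCompactSupport (W.ψ i)) {R : ℝ}
    (hR : ∀ y, R < ‖y‖ → W.ψ i y = 0) (c : CantorData) (hc : |c.y| + 1 + R < 2 ^ c.D)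
    {A : ℕ → ℝ} (hA : ∀ n, 0 ≤ A n) (hcard : ∀ n, ((c.nodes n).card : ℝ) ≤ 2 ^ c.a n)
    {C θ : ℝ} (hC : 0 ≤ C) (hθ : 0 < θ)
    (hbudget : ∀ n, A n ^ p * (c.nodes n).card ≤ C * 2 ^ ((1 - s * p - θ) * c.a n)) :
    ∃ f : (Fin 1 → ℝ) → 𝕜, W.MemBesov p s 1 f ∧ (∀ k, W.scalingCoeff f k = 0) ∧
      (∀ j, j ∉ Set.range c.a → ∀ x, W.detail f j x = 0) ∧
      (∀ t n, W.detail f (c.a n) (fun _ => c.point t) =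
        (A n : 𝕜) * W.ψ i (fun _ => 2 ^ c.a n * c.point t - c.index t n)) := by
  have hp0 : 0 < p := by linarith
  have hcard_image : ∀ n, ((c.nodes n).image fun (k : ℤ) (_ : Fin 1) => k).card =
      (c.nodes n).card := fun n =>
    Finset.card_image_of_injective _ fun k k' h => congrFun h 0
  have hsum : Summable fun n => (2 : ℝ) ^ ((s - (1 : ℕ) / p) * c.a n) *
      (A n * (((c.nodes n).image fun (k : ℤ) (_ : Fin 1) => k).card : ℝ) ^ (1 / p)) := by
    have hq1 : (2 : ℝ) ^ (-(θ / p)) < 1 :=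
      Real.rpow_lt_one_of_one_lt_of_neg (by norm_num) (neg_neg_of_pos (by positivity))
    refine Summable.of_nonneg_of_le (fun n => by have := hA n; positivity) (fun n => ?_)
      ((summable_geometric_of_lt_one (by positivity) hq1).mul_left (C ^ (1 / p)))
    rw [hcard_image]
    have e1 : (2 : ℝ) ^ ((s - (1 : ℕ) / p) * c.a n) * (A n * ((c.nodes n).card : ℝ) ^ (1 / p)) =
        (2 ^ ((s * p - 1) * c.a n) * (A n ^ p * (c.nodes n).card)) ^ (1 / p) := by
      have := hA n
      rw [Real.mul_rpow (by positivity) (by positivity), Real.mul_rpow (by positivity)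
        (by positivity), ← Real.rpow_mul (hA n), mul_one_div_cancel hp0.ne', Real.rpow_one,
        ← Real.rpow_mul (by norm_num)]
      congr 2
      push_cast
      field_simp
    rw [e1]
    calc _ ≤ (2 ^ ((s * p - 1) * c.a n) * (C * 2 ^ ((1 - s * p - θ) * c.a n))) ^ (1 / p) := by
          have := hA n
          have := hbudget n
          gcongr
      _ = C ^ (1 / p) * 2 ^ (-(θ / p) * c.a n) := by
          rw [mul_left_comm, ← Real.rpow_add (by norm_num), Real.mul_rpow hC (by positivity),
            ← Real.rpow_mul (by norm_num)]
          congr 2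
          field_simp
          ring
      _ ≤ C ^ (1 / p) * (2 ^ (-(θ / p))) ^ n := by
          rw [← Real.rpow_natCast _ n, ← Real.rpow_mul (by norm_num)]
          refine mul_le_mul_of_nonneg_left ?_ (by positivity)
          apply Real.rpow_le_rpow_of_exponent_le (by norm_num)
          have h2 : (n : ℝ) ≤ c.a n := by exact_mod_cast c.strictMono_a.le_apply
          have h3 : 0 < θ / p := by positivity
          nlinarith
  obtain ⟨f, hf, hsc, h0, h1⟩ := W.exists_memBesov_of_summable hp hs hψ hsupp c.strictMono_a hA
    (S := fun n => (c.nodes n).image fun k _ => k) (fun n => by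
      rw [hcard_image, one_mul]; exact hcard n) hsum
  exact ⟨f, hf, hsc, h0, fun t n => by rw [h1, W.atomSum_point i hR c hc]⟩

/-- The lacunary series whose set of fast divergence (or slow convergence) is large. -/
theorem exists_lt_packingDim (W : WaveletSystem 𝕜 1) {p s : ℝ} (hp : 1 ≤ p) (hs : 0 < s)
    {i : Fin (2 ^ 1 - 1)} (hψ : Continuous (W.ψ i)) (hsupp : HasCompactSupport (W.ψ i))
    (hsp : 0 < 1 - s * p) {β : ℝ} (hβ1 : -s < β) (hβ2 : β < 1 / p - s) (hβ0 : β ≠ 0) :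
    ∃ f : (Fin 1 → ℝ) → 𝕜, W.MemBesov p s 1 f ∧
      ENNReal.ofReal (1 - s * p - β * p) < packingDim (W.levelSetPlus β f) := by
  have hp0 : 0 < p := by linarith
  have hsp0 : 0 < s * p := by positivity
  set σ := 1 - s * p with hσ
  have hH0 : 0 < σ - β * p := by
    rw [lt_sub_iff_add_lt, lt_div_iff₀ hp0] at hβ2
    linarith
  have hH1 : σ - β * p < 1 := by nlinarith
  -- the exponents
  set B := max (β * p) 0 with hB
  have hB0 : 0 ≤ B := le_max_right _ _
  obtain ⟨e⟩ : Nonempty (JumpExponents σ B (σ - β * p)) := by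
    rcases lt_or_gt_of_ne hβ0 with h | h
    · have : B = 0 := max_eq_right (mul_neg_of_neg_of_pos h hp0).le
      rw [this]
      exact exists_jumpExponents_zero hsp (by linarith) hH0 hH1
    · have hpos : 0 < β * p := mul_pos h hp0
      have : B = β * p := max_eq_left hpos.le
      rw [this]
      exact exists_jumpExponents_pos (by linarith) hpos (by linarith)
  -- the reference interval, on which the wavelet does not vanish
  obtain ⟨R, hR⟩ := exists_forall_eq_zero_of_lt_norm hsupp
  obtain ⟨K, hK⟩ : ∃ K : ℝ, ∀ y, ‖W.ψ i y‖ ≤ K := hψ.bounded_above_of_compact_support hsupp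
  have hK0 : 0 ≤ K := (norm_nonneg _).trans (hK 0)
  obtain ⟨y, ρ, m, hρ, hρ1, hm, hψm⟩ : ∃ y ρ m : ℝ, 0 < ρ ∧ ρ ≤ 1 ∧ 0 < m ∧
      ∀ u ∈ Icc y (y + ρ), m ≤ ‖W.ψ i fun _ => u‖ := by
    obtain ⟨z, hz⟩ := W.exists_wavelet_ne_zero i
    have hz' : z = fun _ => z 0 := by ext j; rw [Subsingleton.elim j 0]
    have hcont : Continuous fun u : ℝ => ‖W.ψ i fun _ => u‖ := by fun_prop
    have hpos : 0 < ‖W.ψ i fun _ => z 0‖ := by rw [← hz']; exact norm_pos_iff.2 hz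
    have hev := hcont.continuousAt.eventually (lt_mem_nhds (half_lt_self hpos))
    obtain ⟨δ, hδ, hball⟩ := Metric.eventually_nhds_iff.1 hev
    refine ⟨z 0, min (δ / 2) 1, _, by positivity, min_le_right _ _, half_pos hpos, fun u hu => ?_⟩
    refine (hball ?_).le
    rw [Real.dist_eq, abs_of_nonneg (by linarith [hu.1])]
    linarith [hu.2, min_le_left (δ / 2) 1]
  obtain ⟨r, hr⟩ : ∃ r : ℕ, 1 ≤ (2 : ℝ) ^ r * (ρ / 2) := by
    obtain ⟨r, hr⟩ := pow_unbounded_of_one_lt (1 / (ρ / 2)) (by norm_num : (1 : ℝ) < 2)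
    exact ⟨r, ((div_lt_iff₀ (by positivity)).1 hr).le⟩
  -- a large separation constant
  have hq1 : (2 : ℝ) ^ (-|β|) < 1 :=
    Real.rpow_lt_one_of_one_lt_of_neg (by norm_num) (neg_neg_of_pos (abs_pos.2 hβ0))
  obtain ⟨D, hD, hDρ, hDR, hκ1, hκ2⟩ : ∃ D : ℕ, 2 ≤ D ∧ 4 ≤ (2 : ℝ) ^ D * ρ ∧
      |y| + 1 + R < 2 ^ D ∧ ((2 : ℝ) ^ (-|β|)) ^ D ≤ 1 / 2 ∧
      K * (2 * ((2 : ℝ) ^ (-|β|)) ^ D) ≤ m / 2 := by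
    have h1 := tendsto_pow_atTop_atTop_of_one_lt (by norm_num : (1 : ℝ) < 2)
    have h2 := tendsto_pow_atTop_nhds_zero_of_lt_one (by positivity) hq1
    have h3 : Tendsto (fun D : ℕ => K * (2 * ((2 : ℝ) ^ (-|β|)) ^ D)) atTop (𝓝 0) := by
      simpa using (h2.const_mul 2).const_mul K
    obtain ⟨D, ⟨⟨⟨a1, a2⟩, a3⟩, a4⟩, a5⟩ := ((((eventually_ge_atTop 2).and
      (h1.eventually_ge_atTop (4 / ρ))).and (h1.eventually_gt_atTop (|y| + 1 + R))).and
      (h2.eventually (ge_mem_nhds (by norm_num : (0 : ℝ) < 1 / 2)))).and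
      (h3.eventually (ge_mem_nhds (half_pos hm))) |>.exists
    exact ⟨D, a1, (div_le_iff₀ hρ).1 a2, a3, a4, a5⟩
  set κ := ((2 : ℝ) ^ (-|β|)) ^ D with hκ
  have hκ0 : 0 ≤ κ := by positivity
  have hκe : κ = 2 ^ (-|β| * D) := by
    rw [hκ, ← Real.rpow_natCast, ← Real.rpow_mul (by norm_num)]
  set c : CantorData := e.data r D D (y := y) hρ hρ1 hD hDρ hr with hc
  have hcn : ∀ n, ((c.nodes n).card : ℝ) ≤ (e.state r D D n).2 := fun n => by
    have := c.card_nodes_le n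
    rw [← e.prod_mult]
    exact_mod_cast this
  have hcard : ∀ n, ((c.nodes n).card : ℝ) ≤ 2 ^ c.a n := fun n => by
    refine (hcn n).trans ((e.state_snd_le r D D hD n).trans ?_)
    rw [← Real.rpow_natCast]
    apply Real.rpow_le_rpow_of_exponent_le (by norm_num)
    exact mul_le_of_le_one_left (Nat.cast_nonneg _) e.κ_le
  have hbudget : ∀ A : ℕ → ℝ, (∀ n, 0 ≤ A n) → (∀ n, A n ^ p ≤ 2 ^ (B * c.a (n + 1))) →
      ∀ n, A n ^ p * (c.nodes n).card ≤
        2 ^ (B * (r + D)) * 2 ^ ((1 - s * p - e.η) * c.a n) := fun A hA hAp n => by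
    refine le_trans ?_ (e.budget_le r D hB0 D hD n)
    rw [mul_comm]
    exact mul_le_mul (hcn n) (hAp n) (Real.rpow_nonneg (hA n) _) (Nat.cast_nonneg _)
  have hdim : ∀ f : (Fin 1 → ℝ) → 𝕜, (∀ t, (fun _ => c.point t) ∈ W.levelSetPlus β f) →
      ENNReal.ofReal (σ - β * p) < packingDim (W.levelSetPlus β f) := fun f hf => by
    refine lt_of_lt_of_le ?_ (c.le_packingDim_of_frequently (e.frequently_mult r D D hD) hf)
    exact (ENNReal.ofReal_lt_ofReal_iff (hH0.trans e.lt_h)).2 e.lt_h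
  have hnorm : ∀ (A : ℝ), 0 ≤ A → ∀ t n, m * A ≤
      ‖(A : 𝕜) * W.ψ i (fun _ => 2 ^ c.a n * c.point t - c.index t n)‖ ∧
      ‖(A : 𝕜) * W.ψ i (fun _ => 2 ^ c.a n * c.point t - c.index t n)‖ ≤ K * A := by
    intro A hA t n
    rw [norm_mul, RCLike.norm_ofReal, abs_of_nonneg hA, mul_comm A]
    exact ⟨mul_le_mul_of_nonneg_right (hψm _ (c.scaled_point_mem t n)) hA,
      mul_le_mul_of_nonneg_right (hK _) hA⟩
  have ha : ∀ n, (c.a n : ℝ) + D ≤ c.a (n + 1) := fun n => by exact_mod_cast c.a_add_le n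
  rcases lt_or_gt_of_ne hβ0 with h | h
  · -- slow convergence: the amplitude is dictated by the previous generation
    set A : ℕ → ℝ := fun n => Nat.casesOn n 1 fun n => 2 ^ (β * c.a n) with hAdef
    have hA : ∀ n, 0 ≤ A n := fun n => by
      cases n with
      | zero => exact zero_le_one
      | succ n => exact Real.rpow_nonneg zero_le_two _
    have hA1 : ∀ n, A n ≤ 1 := fun n => by
      cases n with
      | zero => exact le_rfl
      | succ n =>
        exact Real.rpow_le_one_of_one_le_of_nonpos (by norm_num)
          (mul_nonpos_of_nonpos_of_nonneg h.le (Nat.cast_nonneg _))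
    obtain ⟨f, hf, -, h0, hdet⟩ := W.exists_memBesov_cantor hp hs.le hψ hsupp hR c hDR hA hcard
      (by positivity) e.η_pos (hbudget A hA fun n =>
        (Real.rpow_le_one (hA n) (hA1 n) hp0.le).trans
          (Real.one_le_rpow (by norm_num) (by positivity)))
    refine ⟨f, hf, hdim f fun t => ?_⟩
    refine W.mem_levelSetPlus_of_neg h c.strictMono_a (fun j hj => h0 j hj _) hA (fun n => rfl)
      hκ0 hκ1 (fun n => ?_) hm hK0 hκ2 (fun n => ?_) fun n => ?_
    · rw [hκe, abs_of_neg h, neg_neg]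
      cases n with
      | zero => exact (mul_one ((2 : ℝ) ^ (β * D))).ge
      | succ n =>
        simp only [hAdef]
        rw [← Real.rpow_add (by norm_num)]
        apply Real.rpow_le_rpow_of_exponent_le (by norm_num)
        nlinarith [ha n]
    · rw [hdet]; exact (hnorm _ (hA n) t n).1
    · rw [hdet]; exact (hnorm _ (hA n) t n).2
  · -- fast divergence: the amplitude anticipates the next generation
    set A : ℕ → ℝ := fun n => 2 ^ (β * c.a (n + 1)) with hAdef
    have hA : ∀ n, 0 ≤ A n := fun n => by simp only [hAdef]; positivity
    obtain ⟨f, hf, hsc, h0, hdet⟩ := W.exists_memBesov_cantor hp hs.le hψ hsupp hR c hDR hA hcard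
      (by positivity) e.η_pos (hbudget A hA fun n => by
        simp only [hAdef]
        rw [← Real.rpow_mul (by norm_num)]
        apply Real.rpow_le_rpow_of_exponent_le (by norm_num)
        have := mul_le_mul_of_nonneg_right (le_max_left (β * p) 0)
          (Nat.cast_nonneg (c.a (n + 1)) : (0 : ℝ) ≤ _)
        linarith)
    refine ⟨f, hf, hdim f fun t => ?_⟩
    refine W.mem_levelSetPlus_of_pos h hsc c.strictMono_a (fun j hj => h0 j hj _) (fun n => rfl)
      hκ0 hκ1 (fun n => ?_) hm hK0 hκ2 (fun n => ?_) fun n => ?_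
    · rw [hκe, abs_of_pos h, ← Real.rpow_add (by norm_num)]
      apply Real.rpow_le_rpow_of_exponent_le (by norm_num)
      nlinarith [ha (n + 1)]
    · rw [hdet]; exact (hnorm _ (hA n) t n).1
    · rw [hdet]; exact (hnorm _ (hA n) t n).2

end WaveletSystem

end

theorem theorem3 {𝕜 : Type*} [RCLike 𝕜] {d : ℕ} (W : WaveletSystem 𝕜 d) (p s : ℝ)
    (hp : 1 ≤ p) (hs : 0 ≤ s)
    (hsmooth : ∀ i, ContDiff ℝ ((⌊s⌋₊ + 1 : ℕ) : ℕ∞) (W.ψ i))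
    (hsupp : ∀ i, HasCompactSupport (W.ψ i)) :
    (0 < s → d = 1 → 0 < 1 - s * p →
      ∀ β ∈ Set.Ioo (-s) (1 / p - s) \ {0},
        ∃ f : (Fin d → ℝ) → 𝕜, W.MemBesov p s 1 f ∧
          ENNReal.ofReal (1 - s * p - β * p) < packingDim (W.levelSetPlus β f)) ∧
    ((d : ℝ) - s * p < 0 →
      ∀ β ∈ Set.Ioo (-s) ((d : ℝ) / p - s) \ {0},
        ∀ f : (Fin d → ℝ) → 𝕜, W.MemBesov p s ⊤ f →
          packingDim (W.levelSetPlus β f) ≤ ENNReal.ofReal ((d : ℝ) - s * p - β * p)) := by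
  have hψ : ∀ i, Continuous (W.ψ i) := fun i => (hsmooth i).continuous
  refine ⟨fun hs0 hd hsp β hβ => ?_, fun hd β hβ f hf => ?_⟩
  · subst hd
    exact W.exists_lt_packingDim hp hs0 (hψ ⟨0, by norm_num⟩) (hsupp _) hsp hβ.1.1 hβ.1.2 hβ.2
  · exact W.packingDim_levelSetPlus_le (by linarith) hψ hsupp hd hf hβ.1.2
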